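/- **Setting.** Let $K\subset\mathbb R^2$ be a bounded convex set, and let $\Pi_K$ be the convex hull of the points of a Poisson point process in $K$ whose intensity is Lebesgue measure. For $\theta\in\mathbb R/2\pi$ put $u(\theta)=(\cos\theta,\sin\theta)$ and $n(\theta)=(-\sin\theta,\cos\theta)$. Polygons are oriented counterclockwise: the oriented tangent line of a polygon $\Pi$ at angle $\theta$ is the supporting line of $\Pi$ with direction $u(\theta)$ that has $\Pi$ on its left. A cap of $K$ at angle $\theta$ is a set $K\cap H$ with $H=\{x:\langle n(\theta),x\rangle\le c\}$, $c\in\mathbb R$. *Affine invariant measure.* If $\operatorname{Area}(K)>1$, let $f_K(e^{-1},\theta)$ be the length of the chord $K\cap\partial H$ bounding the cap $K\cap H$ of $K$ at angle $\theta$ that has area $1$; if $\operatorname{Area}(K)\le 1$, let $f_K(e^{-1},\theta)=0$. Put $\mu_K=f_K(e^{-1},\theta)^2\,d\theta$, a measure on $\mathbb R/2\pi$. *Local functionals.* Let $[\alpha,\beta]\subseteq\mathbb R/2\pi$ be an arc, $\alpha\le\beta\le\alpha+2\pi$. Let $N_K(\alpha,\beta)$ be the number of edges of $\Pi_K$ whose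 angle lies in $[\alpha,\beta]$ (a polygon that is a segment has two edges, with opposite angles, and a point or the empty set has none). Let $A_K(\alpha,\beta)$ be the area of the part of $K\setminus\Pi_K$ swept out by the forward tangent rays at angles in $[\alpha,\beta]$, that is, of the set of $x\in K\setminus\Pi_K$ of the form $x=w+t\,u(\theta)$ with $\theta\in[\alpha,\beta]$, $t\ge 0$ and $w$ a point of $\Pi_K$ on the oriented tangent line of $\Pi_K$ at angle $\theta$; if $\Pi_K=\emptyset$, put $A_K(\alpha,\beta)=\operatorname{Area}(K)$. **Proposition 6.1.** There are absolute constants $M_0>0$, $\varepsilon>0$ and $C<\infty$ with the following property. Let $X$ denote either $N$ or $A$. For every bounded convex set $K\subset\mathbb R^2$, every arc $[\alpha,\beta]\subseteq\mathbb R/2\pi$ with $\mu_K([\alpha,\beta])\ge M_0$, and every real $\lambda$ with $|\lambda|<\varepsilon/\mu_K([\alpha,\beta])$, the random variable $\exp(\lambda X_K(\alpha,\beta))$ is integrable and $$\mathbb E\exp\bigl(\lambda X_K(\alpha,\beta)\bigr)\le C .$$ -/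

import Mathlib

open MeasureTheory Set
open scoped ENNReal

noncomputable section

namespace RandomPolygon

/-- The Euclidean plane; `volume` on it is the Lebesgue area measure. -/
abbrev Plane : Type := EuclideanSpace ℝ (Fin 2)

/-- The unit vector `u(θ) = (cos θ, sin θ)`: the direction of an oriented line at angle `θ`. -/
def dir (θ : ℝ) : Plane := !₂[Real.cos θ, Real.sin θ]

/-- The unit normal `n(θ) = (-sin θ, cos θ)` pointing to the left of an oriented line at
angle `θ`. -/
def leftNormal (θ : ℝ) : Plane := !₂[-Real.sin θ, Real.cos θ]

/-- The area of a set, as a real number (only used for bounded sets). -/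
def area (S : Set Plane) : ℝ := (volume S).toReal

/-! ### Caps and the affine invariant measure -/

/-- The closed half-plane to the right of the oriented line `{x | ⟪n(θ), x⟫ = c}` at angle `θ`.
A convex set having this line as its oriented (counterclockwise) tangent line lies on the other
side of it. -/
def halfPlane (θ c : ℝ) : Set Plane := {x | inner ℝ (leftNormal θ) x ≤ c}

/-- The level `c` for which the cap `K ∩ halfPlane θ c` has area `r`. For bounded convex `K` and
`0 < r < area K` the area of this cap is continuous in `c`, and it is strictly increasing where it
lies strictly between `0` and `area K`, so that the supremum below is the unique such level. -/
def capLevel (K : Set Plane) (r θ : ℝ) : ℝ :=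
  sSup {c : ℝ | area (K ∩ halfPlane θ c) ≤ r}

/-- The length of the chord that the line `{x | ⟪n(θ), x⟫ = c}` cuts out of `K`; the line is
parametrized by arc length. -/
def chordLength (K : Set Plane) (θ c : ℝ) : ℝ :=
  (volume {t : ℝ | c • leftNormal θ + t • dir θ ∈ K}).toReal

open Classical in
/-- The function `f_K(x, θ)`: the length of the chord bounding the cap of `K` of area `log (1/x)`
at angle `θ` if `x > exp (-area K)`, and `0` otherwise. -/
def capChord (K : Set Plane) (x θ : ℝ) : ℝ :=
  if Real.exp (-area K) < x then chordLength K θ (capLevel K (Real.log (1 / x)) θ) else 0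

/-- The affine invariant measure `μ_K = f_K(e⁻¹, θ)² dθ`. It is written as a measure on `ℝ` with a
`2π`-periodic density; the measure of an arc of `ℝ/2π` is that of an interval of length at most
`2π` representing it. -/
def affineMeasure (K : Set Plane) : Measure ℝ :=
  volume.withDensity fun θ => ENNReal.ofReal (capChord K (Real.exp (-1)) θ ^ 2)

/-! ### The Poisson process and the random polygon -/

/-- Finite configurations (tuples of any length) of points of the plane. -/
abbrev Config : Type := Σ n : ℕ, Fin n → Plane

/-- The law of the Poisson point process in `K` whose intensity is Lebesgue measure: the number of
points has the Poisson distribution with mean `area K`, and given that there are `n` of them they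
are independent and uniform in `K`. That is, the part of the law on configurations of `n` points
is `exp (-area K) / n!` times the `n`-th power of Lebesgue measure on `K`. -/
def poissonLaw (K : Set Plane) : Measure Config :=
  Measure.sum fun n : ℕ =>
    ENNReal.ofReal (Real.exp (-area K) / (n.factorial : ℝ)) •
      (Measure.pi fun _ : Fin n => (volume.restrict K : Measure Plane)).map
        (fun x => (⟨n, x⟩ : Config))

/-- The random polygon: the convex hull of the points of the configuration. -/
def polygon (ω : Config) : Set Plane := convexHull ℝ (range ω.2)

/-- The points of `P` through which the oriented tangent line of `P` at angle `θ` passes (with `P`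
to the left of the line): a vertex of the polygon `P`, or an edge of it. -/
def face (P : Set Plane) (θ : ℝ) : Set Plane :=
  {w ∈ P | ∀ y ∈ P, inner ℝ (leftNormal θ) w ≤ inner ℝ (leftNormal θ) y}

/-- `N(α, β)`: the number of edges of the polygon `P`, oriented counterclockwise, whose angle lies
in the arc `[α, β]` of `ℝ/2π`. An edge is determined by its angle, so it is the angles
that are counted. -/
def edgeCount (P : Set Plane) (α β : ℝ) : ℝ :=
  (Set.ncard {φ : Real.Angle | ∃ θ ∈ Icc α β, (θ : Real.Angle) = φ ∧ (face P θ).Nontrivial} : ℝ)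

/-- The part of `K \ P` that is swept out by the forward tangent rays of `P` at the angles in
`[α, β]`. For `β = α + 2π` it is all of `K \ P`. If `P` is empty, and so has no tangent rays, it
is all of `K` by convention. -/
def sweptRegion (K P : Set Plane) (α β : ℝ) : Set Plane :=
  {x ∈ K \ P | P.Nonempty →
    ∃ θ ∈ Icc α β, ∃ w ∈ face P θ, ∃ t : ℝ, 0 ≤ t ∧ x = w + t • dir θ}

/-- `A(α, β)`: the area of the part of `K \ P` between the tangent rays at angles `α` and `β`. -/
def missedArea (K P : Set Plane) (α β : ℝ) : ℝ := area (sweptRegion K P α β)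

end RandomPolygon

end

/-!
# Exponential moments of the local functionals of a random polygon

By convexity of the exponential function it suffices to bound `E exp (ρ X)` for a fixed rate `ρ`
when `[α, β]` is short and `μ_K [α, β] ≤ 1/6`: a general arc is cut into `m` such pieces, with `m`
at most a constant multiple of `μ_K [α, β]` (`exists_subdivision`); both functionals are
subadditive, and the exponential of an average is at most the average of the exponentials
(`integrable_exp_of_le_sum`). One may also replace `K` by its interior, which only decreases `μ_K`.

For a short arc of small measure fix a scale `r` with `1 ≤ r < area K`, and a point `q ∈ K` on the
chord that bounds the cap of area `r` at angle `α`. Let `O` and `D` be the intersection and the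
union of the half-planes at angles `α` and `β` to the right of the lines through `q`. If the Poisson
process has a point in `O`, then all tangent lines at angles in `[α, β]` pass to the right of it,
so that the swept region and the vertices of the edges counted lie in `D`
(`face_subset_capUnion`). So the functional is at most the area of `K ∩ D` or the number of points
in `D`.

The main estimate (`area_capInter_capUnion`) is that `K ∩ O` has area at least `r / 2` and `K ∩ D`
at most `2 r`. In polar coordinates around `q`, each of the two parts of `K` in which `D` and `O`
differ from the cap at angle `α` has area at most `∫ ℓ(φ)² dφ` over the arc, where `ℓ(φ)` is the
length of the chord through `q` at angle `φ` (`volume_wedge_le`). By concavity of the chord length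
in the level, a chord that bounds a cap of area `a` satisfies `ℓ(φ)² ≤ 2 max(1, a) f_K(e⁻¹, φ)²`
(`chordLength_sq_le`), provided that `area K ≥ 2`. The caps here have area at most that of `K ∩ D`,
and the resulting inequality closes up because `μ_K [α, β]` is small.

Finally let `k` be the largest integer scale at which `O` contains no point. This happens with
probability at most `exp (-k / 2)`, while the functional is then controlled by the scale `k + 1`.
Summing a geometric series gives the bound (`lintegral_exp_le_of_scales`), where the Laplace
functional of the Poisson process (`lintegral_poissonLaw_prod_le`) takes care of the dependence
between the number of points in `D` and the absence of points in `O`.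
-/

namespace RandomPolygon

open scoped Pointwise

variable {K : Set Plane} {R : ℝ}

/-! ### Moving frames of the plane -/

theorem inner_leftNormal (θ : ℝ) (x : Plane) :
    inner ℝ (leftNormal θ) x = -Real.sin θ * x 0 + Real.cos θ * x 1 := by
  simp [leftNormal, PiLp.inner_apply, Fin.sum_univ_two, mul_comm]

theorem inner_dir (θ : ℝ) (x : Plane) :
    inner ℝ (dir θ) x = Real.cos θ * x 0 + Real.sin θ * x 1 := by
  simp [dir, PiLp.inner_apply, Fin.sum_univ_two, mul_comm]

theorem inner_leftNormal_dir (θ φ : ℝ) :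
    inner ℝ (leftNormal θ) (dir φ) = Real.sin (φ - θ) := by
  rw [inner_leftNormal, Real.sin_sub]; simp [dir]; ring

theorem inner_dir_dir (θ φ : ℝ) : inner ℝ (dir θ) (dir φ) = Real.cos (φ - θ) := by
  rw [inner_dir, Real.cos_sub]; simp [dir]; ring

theorem inner_dir_leftNormal (θ : ℝ) : inner ℝ (dir θ) (leftNormal θ) = 0 := by
  rw [inner_dir]; simp [leftNormal]; ring

theorem inner_leftNormal_leftNormal (θ : ℝ) :
    inner ℝ (leftNormal θ) (leftNormal θ) = 1 := by
  rw [inner_leftNormal]; simp [leftNormal]; nlinarith [Real.sin_sq_add_cos_sq θ]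

theorem norm_dir (θ : ℝ) : ‖dir θ‖ = 1 := by
  have := real_inner_self_eq_norm_sq (dir θ)
  rw [inner_dir_dir, sub_self, Real.cos_zero] at this
  nlinarith [norm_nonneg (dir θ)]

theorem norm_leftNormal (θ : ℝ) : ‖leftNormal θ‖ = 1 := by
  have := real_inner_self_eq_norm_sq (leftNormal θ)
  rw [inner_leftNormal_leftNormal] at this
  nlinarith [norm_nonneg (leftNormal θ)]

/-- Every vector is the sum of its components in the frame at angle `θ`. -/
theorem frame_decomp (θ : ℝ) (x : Plane) :
    (inner ℝ (leftNormal θ) x : ℝ) • leftNormal θ + (inner ℝ (dir θ) x : ℝ) • dir θ = x := by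
  rw [inner_leftNormal, inner_dir]
  have := Real.sin_sq_add_cos_sq θ
  ext i
  fin_cases i
  · simp [dir, leftNormal]
    linear_combination x 0 * this
  · simp [dir, leftNormal]
    linear_combination x 1 * this

theorem cos_smul_dir_add_sin_smul_leftNormal (θ ψ : ℝ) :
    Real.cos ψ • dir θ + Real.sin ψ • leftNormal θ = dir (θ + ψ) := by
  ext i
  fin_cases i <;> simp [dir, leftNormal, Real.cos_add, Real.sin_add] <;> ring

/-- The coordinates along `u(θ)` and `n(θ)` are orthonormal, so they transport area to the product
measure. -/
theorem measurePreserving_frame (θ : ℝ) :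
    MeasurePreserving (fun p : ℝ × ℝ => p.1 • dir θ + p.2 • leftNormal θ) := by
  have hon : Orthonormal ℝ ![dir θ, leftNormal θ] := by
    refine ⟨fun i => ?_, fun i j hij => ?_⟩
    · fin_cases i
      · exact norm_dir θ
      · exact norm_leftNormal θ
    · fin_cases i <;> fin_cases j
      · exact absurd rfl hij
      · exact inner_dir_leftNormal θ
      · exact (real_inner_comm _ _).trans (inner_dir_leftNormal θ)
      · exact absurd rfl hij
  let b := (basisOfOrthonormalOfCardEqFinrank hon (by simp)).toOrthonormalBasis (by simpa using hon)
  have h0 : b 0 = dir θ := by simp [b]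
  have h1 : b 1 = leftNormal θ := by simp [b]
  have key := b.measurePreserving_repr_symm.comp
    ((PiLp.volume_preserving_toLp (Fin 2)).comp (volume_preserving_finTwoArrow ℝ).symm)
  have e : (fun p : ℝ × ℝ => p.1 • dir θ + p.2 • leftNormal θ) =
      b.repr.symm ∘ (WithLp.toLp 2) ∘ (MeasurableEquiv.finTwoArrow (α := ℝ)).symm := by
    funext p
    simp [← b.sum_repr_symm, Fin.sum_univ_two, h0, h1, MeasurableEquiv.finTwoArrow]
  exact e ▸ key

/-- Between `α` and `β` the normal is a nonnegative combination of the two extreme normals. -/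
theorem sin_mul_inner_leftNormal (α β θ : ℝ) (x : Plane) :
    Real.sin (β - α) * inner ℝ (leftNormal θ) x =
      Real.sin (β - θ) * inner ℝ (leftNormal α) x +
        Real.sin (θ - α) * inner ℝ (leftNormal β) x := by
  simp only [inner_leftNormal, Real.sin_sub]
  ring

theorem inner_leftNormal_nonpos_of_mem_Icc {α β θ : ℝ} (hθ : θ ∈ Icc α β) (hβ : β < α + Real.pi)
    {x : Plane} (h1 : inner ℝ (leftNormal α) x ≤ 0) (h2 : inner ℝ (leftNormal β) x ≤ 0) :
    inner ℝ (leftNormal θ) x ≤ 0 := by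
  rcases (hθ.1.trans hθ.2).eq_or_lt with rfl | hlt
  · rwa [← le_antisymm hθ.1 hθ.2]
  have hs : 0 < Real.sin (β - α) := Real.sin_pos_of_pos_of_lt_pi (by linarith) (by linarith)
  have ha : 0 ≤ Real.sin (β - θ) :=
    Real.sin_nonneg_of_nonneg_of_le_pi (by linarith [hθ.2]) (by linarith [hθ.1])
  have hb : 0 ≤ Real.sin (θ - α) :=
    Real.sin_nonneg_of_nonneg_of_le_pi (by linarith [hθ.1]) (by linarith [hθ.2])
  have := sin_mul_inner_leftNormal α β θ x
  by_contra! hc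
  nlinarith [mul_pos hs hc, mul_nonneg ha (neg_nonneg.2 h1), mul_nonneg hb (neg_nonneg.2 h2)]

theorem inner_leftNormal_pos_of_mem_Icc {α β θ : ℝ} (hθ : θ ∈ Icc α β) (hβ : β < α + Real.pi)
    {x : Plane} (h1 : 0 < inner ℝ (leftNormal α) x) (h2 : 0 < inner ℝ (leftNormal β) x) :
    0 < inner ℝ (leftNormal θ) x := by
  rcases hθ.1.eq_or_lt with rfl | h1lt
  · exact h1
  have hs : 0 < Real.sin (β - α) :=
    Real.sin_pos_of_pos_of_lt_pi (by linarith [hθ.2]) (by linarith)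
  have ha : 0 ≤ Real.sin (β - θ) :=
    Real.sin_nonneg_of_nonneg_of_le_pi (by linarith [hθ.2]) (by linarith [hθ.1])
  have hb : 0 < Real.sin (θ - α) :=
    Real.sin_pos_of_pos_of_lt_pi (by linarith [hθ.1]) (by linarith [hθ.2])
  have := sin_mul_inner_leftNormal α β θ x
  by_contra! hc
  nlinarith [mul_pos hb h2, mul_nonneg ha h1.le, mul_nonneg hs.le (neg_nonneg.2 hc)]

/-! ### Chords and caps -/

/-- The parameters, along the line `{x | ⟪n(θ), x⟫ = c}`, of its points in `K`. -/
def slice (K : Set Plane) (θ c : ℝ) : Set ℝ := {t | c • leftNormal θ + t • dir θ ∈ K}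

theorem inner_leftNormal_line (θ c t : ℝ) :
    inner ℝ (leftNormal θ) (c • leftNormal θ + t • dir θ) = c := by
  simp [inner_add_right, inner_smul_right, norm_leftNormal, inner_leftNormal_dir]

theorem inner_dir_line (θ c t : ℝ) :
    inner ℝ (dir θ) (c • leftNormal θ + t • dir θ) = t := by
  simp [inner_add_right, inner_smul_right, inner_dir_leftNormal, norm_dir]


theorem slice_subset_Icc (hR : K ⊆ Metric.closedBall 0 R) (θ c : ℝ) :
    slice K θ c ⊆ Icc (-R) R := by
  intro t ht
  have h1 : ‖c • leftNormal θ + t • dir θ‖ ≤ R := by simpa using hR ht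
  have h2 := abs_real_inner_le_norm (dir θ) (c • leftNormal θ + t • dir θ)
  rw [inner_dir_line, norm_dir, one_mul] at h2
  exact abs_le.1 (h2.trans h1)

theorem volume_slice_ne_top (hb : Bornology.IsBounded K) (θ c : ℝ) :
    volume (slice K θ c) ≠ ∞ := by
  obtain ⟨R, hR⟩ := hb.subset_closedBall 0
  exact ((measure_mono (slice_subset_Icc hR θ c)).trans_lt (by simp)).ne

theorem chordLength_eq (θ c : ℝ) : chordLength K θ c = (volume (slice K θ c)).toReal := rfl

theorem chordLength_nonneg (θ c : ℝ) : 0 ≤ chordLength K θ c := ENNReal.toReal_nonneg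

theorem ofReal_chordLength (hb : Bornology.IsBounded K) (θ c : ℝ) :
    ENNReal.ofReal (chordLength K θ c) = volume (slice K θ c) :=
  ENNReal.ofReal_toReal (volume_slice_ne_top hb θ c)

theorem chordLength_le (hR : K ⊆ Metric.closedBall 0 R) (hR0 : 0 ≤ R) (θ c : ℝ) :
    chordLength K θ c ≤ 2 * R := by
  rw [chordLength_eq]
  refine ENNReal.toReal_le_of_le_ofReal (by positivity) ?_
  refine (measure_mono (slice_subset_Icc hR θ c)).trans ?_
  rw [Real.volume_Icc]
  exact ENNReal.ofReal_le_ofReal (by linarith)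

theorem isOpen_slice (ho : IsOpen K) (θ c : ℝ) : IsOpen (slice K θ c) :=
  ho.preimage (by fun_prop)

/-- Slices of a convex set depend concavely on the level. -/
theorem combo_mem_slice (hK : Convex ℝ K) {θ c c' t t' a b : ℝ} (ht : t ∈ slice K θ c)
    (ht' : t' ∈ slice K θ c') (ha : 0 ≤ a) (hb : 0 ≤ b) (hab : a + b = 1) :
    a * t + b * t' ∈ slice K θ (a * c + b * c') := by
  have := hK ht ht' ha hb hab
  simp only [slice, mem_ofPred_eq]
  convert this using 1
  module

theorem slice_ordConnected (hK : Convex ℝ K) (θ c : ℝ) : (slice K θ c).OrdConnected := by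
  refine Convex.ordConnected fun t ht t' ht' a b ha hb hab => ?_
  have := combo_mem_slice hK ht ht' ha hb hab
  rwa [← add_mul, hab, one_mul] at this

theorem bddAbove_slice (hb : Bornology.IsBounded K) (θ c : ℝ) : BddAbove (slice K θ c) := by
  obtain ⟨R, hR⟩ := hb.subset_closedBall 0
  exact bddAbove_Icc.mono (slice_subset_Icc hR θ c)

theorem bddBelow_slice (hb : Bornology.IsBounded K) (θ c : ℝ) : BddBelow (slice K θ c) := by
  obtain ⟨R, hR⟩ := hb.subset_closedBall 0
  exact bddBelow_Icc.mono (slice_subset_Icc hR θ c)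

theorem chordLength_eq_sSup_sub_sInf (hK : Convex ℝ K) (hb : Bornology.IsBounded K) {θ c : ℝ}
    (hne : (slice K θ c).Nonempty) :
    chordLength K θ c = sSup (slice K θ c) - sInf (slice K θ c) := by
  have h1 : Ioo (sInf (slice K θ c)) (sSup (slice K θ c)) ⊆ slice K θ c :=
    IsConnected.Ioo_csInf_csSup_subset ⟨hne, (slice_ordConnected hK θ c).isPreconnected⟩
      (bddBelow_slice hb θ c) (bddAbove_slice hb θ c)
  have h2 := subset_Icc_csInf_csSup (bddBelow_slice hb θ c) (bddAbove_slice hb θ c)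
  have h3 : volume (slice K θ c) =
      ENNReal.ofReal (sSup (slice K θ c) - sInf (slice K θ c)) := by
    refine le_antisymm ?_ ?_
    · simpa using measure_mono (μ := volume) h2
    · simpa using measure_mono (μ := volume) h1
  rw [chordLength_eq, h3, ENNReal.toReal_ofReal]
  linarith [csInf_le_csSup hne (bddBelow_slice hb θ c) (bddAbove_slice hb θ c)]

theorem sub_le_chordLength (hK : Convex ℝ K) (hb : Bornology.IsBounded K) {θ c t t' : ℝ}
    (ht : t ∈ slice K θ c) (ht' : t' ∈ slice K θ c) : t' - t ≤ chordLength K θ c := by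
  rw [chordLength_eq_sSup_sub_sInf hK hb ⟨t, ht⟩]
  linarith [le_csSup (bddAbove_slice hb θ c) ht', csInf_le (bddBelow_slice hb θ c) ht]

/-- The Brunn-Minkowski inequality for chords: the length of the chord is a concave function of
the level where the chord is nonempty. -/
theorem chordLength_concave (hK : Convex ℝ K) (hb : Bornology.IsBounded K) {θ c c' a b : ℝ}
    (hne : (slice K θ c).Nonempty) (hne' : (slice K θ c').Nonempty)
    (ha : 0 ≤ a) (hb0 : 0 ≤ b) (hab : a + b = 1) :
    a * chordLength K θ c + b * chordLength K θ c' ≤ chordLength K θ (a * c + b * c') := by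
  have hsub : a • slice K θ c + b • slice K θ c' ⊆ slice K θ (a * c + b * c') := by
    rintro _ ⟨_, ⟨t, ht, rfl⟩, _, ⟨t', ht', rfl⟩, rfl⟩
    exact combo_mem_slice hK ht ht' ha hb0 hab
  have hn1 : (a • slice K θ c).Nonempty := hne.smul_set
  have hn2 : (b • slice K θ c').Nonempty := hne'.smul_set
  have hn := hn1.add hn2
  have hS := csSup_le_csSup (bddAbove_slice hb _ _) hn hsub
  have hI := csInf_le_csInf (bddBelow_slice hb _ _) hn hsub
  rw [csSup_add hn1 ((bddAbove_slice hb _ _).smul_of_nonneg ha) hn2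
    ((bddAbove_slice hb _ _).smul_of_nonneg hb0), Real.sSup_smul_of_nonneg ha,
    Real.sSup_smul_of_nonneg hb0] at hS
  rw [csInf_add hn1 ((bddBelow_slice hb _ _).smul_of_nonneg ha) hn2
    ((bddBelow_slice hb _ _).smul_of_nonneg hb0), Real.sInf_smul_of_nonneg ha,
    Real.sInf_smul_of_nonneg hb0] at hI
  rw [chordLength_eq_sSup_sub_sInf hK hb hne, chordLength_eq_sSup_sub_sInf hK hb hne',
    chordLength_eq_sSup_sub_sInf hK hb (hn.mono hsub)]
  simp only [smul_eq_mul] at hS hI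
  linarith

/-- Cavalieri's principle for the slices at angle `θ`. -/
theorem volume_inter_level (hm : MeasurableSet K) (hb : Bornology.IsBounded K) (θ : ℝ) {S : Set ℝ}
    (hS : MeasurableSet S) :
    volume {x ∈ K | inner ℝ (leftNormal θ) x ∈ S} =
      ∫⁻ c in S, ENNReal.ofReal (chordLength K θ c) := by
  have hms : MeasurableSet {x ∈ K | inner ℝ (leftNormal θ) x ∈ S} :=
    hm.inter ((by fun_prop : Measurable fun x : Plane => inner ℝ (leftNormal θ) x) hS)
  rw [← (measurePreserving_frame θ).measure_preimage hms.nullMeasurableSet, Measure.volume_eq_prod,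
    Measure.prod_apply_symm ((measurePreserving_frame θ).measurable hms),
    ← lintegral_indicator hS]
  congr 1
  funext c
  by_cases hc : c ∈ S
  · rw [indicator_of_mem hc, ofReal_chordLength hb]
    congr 1
    ext t
    simp [slice, add_comm (t • dir θ), inner_leftNormal_line, hc]
  · rw [indicator_of_notMem hc]
    have : ((fun x : ℝ => (x, c)) ⁻¹' ((fun p : ℝ × ℝ => p.1 • dir θ + p.2 • leftNormal θ) ⁻¹'
        {x ∈ K | inner ℝ (leftNormal θ) x ∈ S})) = ∅ := by
      ext t
      simp [add_comm (t • dir θ), inner_leftNormal_line, hc]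
    rw [this, measure_empty]

theorem volume_ne_top (hb : Bornology.IsBounded K) : volume K ≠ ∞ := hb.measure_lt_top.ne

theorem ofReal_area (hb : Bornology.IsBounded K) : ENNReal.ofReal (area K) = volume K :=
  ENNReal.ofReal_toReal (volume_ne_top hb)

theorem area_mono {S T : Set Plane} (hb : Bornology.IsBounded T) (h : S ⊆ T) : area S ≤ area T :=
  ENNReal.toReal_mono (volume_ne_top hb) (measure_mono h)

theorem area_nonneg (S : Set Plane) : 0 ≤ area S := ENNReal.toReal_nonneg

theorem measurableSet_halfPlane (θ c : ℝ) : MeasurableSet (halfPlane θ c) :=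
  measurableSet_le (by fun_prop) (by fun_prop)

theorem area_inter_halfPlane_mono (hb : Bornology.IsBounded K) (θ : ℝ) :
    Monotone fun c => area (K ∩ halfPlane θ c) := fun _ _ h =>
  area_mono (hb.subset inter_subset_left)
    (inter_subset_inter_right K fun _ hx => le_trans hx h)

theorem area_inter_halfPlane_sub (hm : MeasurableSet K) (hb : Bornology.IsBounded K) (θ : ℝ)
    {c c' : ℝ} (h : c ≤ c') :
    area (K ∩ halfPlane θ c') - area (K ∩ halfPlane θ c) =
      (∫⁻ s in Ioc c c', ENNReal.ofReal (chordLength K θ s)).toReal := by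
  rw [← volume_inter_level hm hb θ measurableSet_Ioc]
  have hU : K ∩ halfPlane θ c' = K ∩ halfPlane θ c ∪
      {x ∈ K | inner ℝ (leftNormal θ) x ∈ Ioc c c'} := by
    ext x
    simp only [halfPlane, mem_inter_iff, mem_ofPred_eq, mem_union, mem_Ioc]
    constructor
    · rintro ⟨h1, h2⟩
      rcases le_or_gt (inner ℝ (leftNormal θ) x) c with h3 | h3
      · exact Or.inl ⟨h1, h3⟩
      · exact Or.inr ⟨h1, h3, h2⟩
    · rintro (⟨h1, h2⟩ | ⟨h1, h2, h3⟩)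
      · exact ⟨h1, h2.trans h⟩
      · exact ⟨h1, h3⟩
  have hd : Disjoint (K ∩ halfPlane θ c) {x ∈ K | inner ℝ (leftNormal θ) x ∈ Ioc c c'} := by
    rw [disjoint_left]
    rintro x ⟨-, h2⟩ ⟨-, h3, -⟩
    exact absurd h2 (not_le.2 h3)
  have hms : MeasurableSet {x ∈ K | inner ℝ (leftNormal θ) x ∈ Ioc c c'} :=
    hm.inter ((by fun_prop : Measurable fun x : Plane => inner ℝ (leftNormal θ) x)
      measurableSet_Ioc)
  rw [area, area, hU, measure_union hd hms, ENNReal.toReal_add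
    (volume_ne_top (hb.subset inter_subset_left)) (volume_ne_top (hb.subset (sep_subset _ _)))]
  ring

theorem continuous_area_inter_halfPlane (hm : MeasurableSet K) (hb : Bornology.IsBounded K)
    (θ : ℝ) : Continuous fun c => area (K ∩ halfPlane θ c) := by
  obtain ⟨R, hR0, hR⟩ := hb.subset_closedBall_lt 0 0
  have key : ∀ c c', c ≤ c' →
      area (K ∩ halfPlane θ c') - area (K ∩ halfPlane θ c) ≤ 2 * R * (c' - c) := by
    intro c c' h
    rw [area_inter_halfPlane_sub hm hb θ h]
    refine ENNReal.toReal_le_of_le_ofReal (by nlinarith) ?_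
    calc _ ≤ ∫⁻ s in Ioc c c', ENNReal.ofReal (2 * R) :=
          lintegral_mono fun s => ENNReal.ofReal_le_ofReal (chordLength_le hR hR0.le θ s)
      _ = _ := by
          rw [setLIntegral_const, Real.volume_Ioc, ← ENNReal.ofReal_mul (by positivity)]
  refine (LipschitzWith.of_dist_le_mul (K := ⟨2 * R, by positivity⟩) fun c c' => ?_).continuous
  simp only [Real.dist_eq]
  rcases le_total c c' with h | h
  · rw [abs_sub_comm, abs_sub_comm c c', abs_of_nonneg (sub_nonneg.2 h),
      abs_of_nonneg (sub_nonneg.2 (area_inter_halfPlane_mono hb θ h))]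
    exact key c c' h
  · rw [abs_of_nonneg (sub_nonneg.2 h),
      abs_of_nonneg (sub_nonneg.2 (area_inter_halfPlane_mono hb θ h))]
    exact key c' c h

/-- The cap at the level `capLevel K r θ` does have area `r`. -/
theorem area_inter_halfPlane_capLevel (hm : MeasurableSet K) (hb : Bornology.IsBounded K) (θ : ℝ)
    {r : ℝ} (h0 : 0 ≤ r) (hr : r < area K) :
    area (K ∩ halfPlane θ (capLevel K r θ)) = r := by
  obtain ⟨R, hR0, hR⟩ := hb.subset_closedBall_lt 0 0
  have hcont := continuous_area_inter_halfPlane hm hb θ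
  have habs : ∀ x ∈ K, |inner ℝ (leftNormal θ) x| ≤ R := fun x hx => by
    have h1 := abs_real_inner_le_norm (leftNormal θ) x
    rw [norm_leftNormal, one_mul] at h1
    exact h1.trans (by simpa using hR hx)
  set S := {c : ℝ | area (K ∩ halfPlane θ c) ≤ r} with hS
  have hclosed : IsClosed S := isClosed_le hcont continuous_const
  have hne : S.Nonempty := by
    refine ⟨-R - 1, ?_⟩
    have : K ∩ halfPlane θ (-R - 1) = ∅ := by
      ext x
      simp only [halfPlane, mem_inter_iff, mem_ofPred_eq, mem_empty_iff_false, iff_false, not_and,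
        not_le]
      intro hx
      linarith [(abs_le.1 (habs x hx)).1]
    simp [hS, this, area, h0]
  have hbdd : BddAbove S := by
    refine ⟨R, fun c hc => ?_⟩
    by_contra! hlt
    have : K ∩ halfPlane θ c = K := by
      refine inter_eq_left.2 fun x hx => ?_
      exact ((abs_le.1 (habs x hx)).2).trans hlt.le
    simp only [hS, mem_ofPred_eq, this] at hc
    linarith
  refine le_antisymm (hclosed.csSup_mem hne hbdd) ?_
  refine ge_of_tendsto (hcont.continuousWithinAt (s := Ioi (sSup S)) (x := sSup S)).tendsto ?_
  filter_upwards [self_mem_nhdsWithin] with c hc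
  by_contra! hlt
  exact absurd (le_csSup hbdd (show c ∈ S from hlt.le)) (not_le.2 hc)

theorem slice_nonempty_of_area (hK : Convex ℝ K) {θ c : ℝ}
    (h0 : 0 < area (K ∩ halfPlane θ c)) (h1 : area (K ∩ halfPlane θ c) < area K) :
    ∃ q ∈ K, inner ℝ (leftNormal θ) q = c := by
  obtain ⟨x, hx, hxc⟩ : (K ∩ halfPlane θ c).Nonempty := by
    rw [nonempty_iff_ne_empty]
    intro h
    simp [h, area] at h0
  obtain ⟨y, hy, hyc⟩ : ∃ y ∈ K, c ≤ inner ℝ (leftNormal θ) y := by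
    by_contra! h
    have hs : K ⊆ halfPlane θ c := fun y hy => (h y hy).le
    rw [inter_eq_left.2 hs] at h1
    exact lt_irrefl _ h1
  exact hK.isPreconnected.intermediate_value hx hy (f := fun x => inner ℝ (leftNormal θ) x)
    (by fun_prop) ⟨hxc, hyc⟩

theorem mem_slice_of_mem {q : Plane} (hq : q ∈ K) (θ : ℝ) :
    inner ℝ (dir θ) q ∈ slice K θ (inner ℝ (leftNormal θ) q) := by
  simpa [slice, frame_decomp] using hq

theorem chordLength_pos (ho : IsOpen K) (hb : Bornology.IsBounded K) {θ c : ℝ}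
    (hne : (slice K θ c).Nonempty) : 0 < chordLength K θ c :=
  ENNReal.toReal_pos ((isOpen_slice ho θ c).measure_pos _ hne).ne' (volume_slice_ne_top hb θ c)

/-! ### Comparison of parallel chords -/

theorem setLIntegral_ofReal_affine {p m a b : ℝ} (hab : a ≤ b)
    (h0 : ∀ s ∈ Ioc a b, 0 ≤ p + m * s) :
    ∫⁻ s in Ioc a b, ENNReal.ofReal (p + m * s) =
      ENNReal.ofReal (p * (b - a) + m * ((b ^ 2 - a ^ 2) / 2)) := by
  have hint : IntegrableOn (fun s : ℝ => p + m * s) (Ioc a b) :=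
    ((by fun_prop : Continuous fun s : ℝ => p + m * s).integrableOn_Icc).mono_set
      Ioc_subset_Icc_self
  rw [← ofReal_integral_eq_lintegral_ofReal hint
    ((ae_restrict_iff' measurableSet_Ioc).2 (ae_of_all _ h0)),
    ← intervalIntegral.integral_of_le hab, intervalIntegral.integral_add (by simp)
      ((by fun_prop : Continuous fun s : ℝ => m * s).intervalIntegrable _ _),
    intervalIntegral.integral_const_mul, integral_id]
  simp [mul_comm]

/-- The square of the chord length, as a function of the area of the cap, grows at most
proportionally to that area. Indeed, if the chord grows from `g₁` to `g₂`, then the part of `K`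
before the first chord lies in a triangle of base `g₁` and the part between the chords contains
the trapezoid that extends this triangle. -/
theorem chordLength_sq_mul_area_le (hK : Convex ℝ K) (ho : IsOpen K)
    (hb : Bornology.IsBounded K) {θ c₁ c : ℝ} (hc : c₁ ≤ c) (hne : (slice K θ c₁).Nonempty) :
    chordLength K θ c ^ 2 * area (K ∩ halfPlane θ c₁) ≤
      chordLength K θ c₁ ^ 2 * area (K ∩ halfPlane θ c) := by
  have hm := ho.measurableSet
  set g := chordLength K θ with hg
  have hg1 : 0 < g c₁ := chordLength_pos ho hb hne
  have hmono := area_inter_halfPlane_mono hb θ hc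
  have hB0 : 0 ≤ area (K ∩ halfPlane θ c₁) := area_nonneg _
  simp only at hmono
  rcases le_or_gt (g c) (g c₁) with hle | hlt
  · exact mul_le_mul (pow_le_pow_left₀ (chordLength_nonneg θ c) hle 2) hmono hB0 (by positivity)
  have hcc : c₁ < c := hc.lt_of_ne fun h => by simp [h] at hlt
  have hg2 : 0 < g c := hg1.trans hlt
  have hne2 : (slice K θ c).Nonempty := by
    rw [nonempty_iff_ne_empty]
    intro h
    rw [hg, chordLength_eq, h] at hg2
    simp at hg2
  set m := (g c - g c₁) / (c - c₁) with hmdef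
  have hmpos : 0 < m := div_pos (by linarith) (by linarith)
  have hmc : m * (c - c₁) = g c - g c₁ := div_mul_cancel₀ _ (by linarith)
  set p := g c₁ - m * c₁ with hp
  -- Below `c₁` the chord length is dominated by the affine function.
  have hleft : ∀ s ∈ Iic c₁, ENNReal.ofReal (g s) ≤ ENNReal.ofReal (p + m * s) := by
    intro s hs
    rcases (chordLength_nonneg (K := K) θ s).eq_or_lt with h0 | h0
    · rw [hg, ← h0]; simp
    have hnes : (slice K θ s).Nonempty := by
      rw [nonempty_iff_ne_empty]
      intro h
      rw [chordLength_eq, h] at h0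
      simp at h0
    refine ENNReal.ofReal_le_ofReal ?_
    have hs' : s ≤ c₁ := hs
    have hpos : 0 < c - s := by linarith
    have key := chordLength_concave hK hb hnes hne2
      (div_nonneg (sub_nonneg.2 hc) hpos.le) (div_nonneg (sub_nonneg.2 hs') hpos.le)
      (by field_simp; ring)
    rw [show (c - c₁) / (c - s) * s + (c₁ - s) / (c - s) * c = c₁ by field_simp; ring,
      ← hg] at key
    have key2 : (c - c₁) * g s + (c₁ - s) * g c ≤ (c - s) * g c₁ := by
      have := mul_le_mul_of_nonneg_left key hpos.le
      have e : (c - s) * ((c - c₁) / (c - s) * g s + (c₁ - s) / (c - s) * g c) =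
        (c - c₁) * g s + (c₁ - s) * g c := by field_simp
      linarith
    have hgc : g c = g c₁ + m * (c - c₁) := by linarith
    rw [hgc] at key2
    have hccp : 0 < c - c₁ := by linarith
    refine le_of_mul_le_mul_left ?_ hccp
    rw [hp]
    nlinarith
  have hright : ∀ s ∈ Ioc c₁ c, ENNReal.ofReal (p + m * s) ≤ ENNReal.ofReal (g s) := by
    intro s hs
    refine ENNReal.ofReal_le_ofReal ?_
    have hpos : 0 < c - c₁ := by linarith
    have key := chordLength_concave hK hb hne hne2
      (div_nonneg (sub_nonneg.2 hs.2) hpos.le) (div_nonneg (sub_nonneg.2 hs.1.le) hpos.le)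
      (by field_simp; ring)
    rw [show (c - s) / (c - c₁) * c₁ + (s - c₁) / (c - c₁) * c = s by field_simp; ring,
      ← hg] at key
    have e : (c - s) / (c - c₁) * g c₁ + (s - c₁) / (c - c₁) * g c = p + m * s := by
      rw [hp, hmdef]; field_simp; ring
    linarith
  -- The two bounds are the areas of the triangle below `c₁` and of the trapezoid above it.
  have hB : area (K ∩ halfPlane θ c₁) ≤ g c₁ ^ 2 / (2 * m) := by
    refine ENNReal.toReal_le_of_le_ofReal (by positivity) ?_
    have e := volume_inter_level hm hb θ (measurableSet_Iic (a := c₁))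
    calc volume (K ∩ halfPlane θ c₁) = ∫⁻ s in Iic c₁, ENNReal.ofReal (g s) := e
      _ ≤ ∫⁻ s in Iic c₁, ENNReal.ofReal (p + m * s) := setLIntegral_mono' measurableSet_Iic hleft
      _ ≤ ∫⁻ s in Ioc (c₁ - g c₁ / m) c₁, ENNReal.ofReal (p + m * s) := by
          rw [← lintegral_indicator measurableSet_Iic, ← lintegral_indicator measurableSet_Ioc]
          refine lintegral_mono fun s => ?_
          by_cases h1 : s ∈ Ioc (c₁ - g c₁ / m) c₁
          · rw [indicator_of_mem h1, indicator_of_mem (show s ∈ Iic c₁ from h1.2)]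
          · rw [indicator_of_notMem h1]
            by_cases h2 : s ∈ Iic c₁
            · rw [indicator_of_mem h2, nonpos_iff_eq_zero, ENNReal.ofReal_eq_zero]
              have h3 : s ≤ c₁ - g c₁ / m := by
                by_contra! h3
                exact h1 ⟨h3, h2⟩
              have h4 := mul_le_mul_of_nonneg_left h3 hmpos.le
              rw [mul_sub, mul_div_cancel₀ _ hmpos.ne'] at h4
              linarith
            · rw [indicator_of_notMem h2]
      _ = ENNReal.ofReal (g c₁ ^ 2 / (2 * m)) := by
          rw [setLIntegral_ofReal_affine]
          · congr 1
            rw [hp]; field_simp; ring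
          · have : 0 ≤ g c₁ / m := by positivity
            linarith
          · intro s hs
            have h4 := mul_le_mul_of_nonneg_left hs.1.le hmpos.le
            rw [mul_sub, mul_div_cancel₀ _ hmpos.ne'] at h4
            linarith
  have hM : (g c ^ 2 - g c₁ ^ 2) / (2 * m) ≤
      area (K ∩ halfPlane θ c) - area (K ∩ halfPlane θ c₁) := by
    rw [area_inter_halfPlane_sub hm hb θ hc, ← volume_inter_level hm hb θ measurableSet_Ioc]
    refine (ENNReal.ofReal_le_iff_le_toReal (volume_ne_top (hb.subset (sep_subset _ _)))).1 ?_
    rw [volume_inter_level hm hb θ measurableSet_Ioc]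
    calc ENNReal.ofReal ((g c ^ 2 - g c₁ ^ 2) / (2 * m))
        = ∫⁻ s in Ioc c₁ c, ENNReal.ofReal (p + m * s) := by
          rw [setLIntegral_ofReal_affine hc]
          · congr 1
            rw [show g c = g c₁ + m * (c - c₁) by linarith, hp]; field_simp; ring
          · intro s hs
            have := mul_lt_mul_of_pos_left hs.1 hmpos
            linarith
      _ ≤ _ := setLIntegral_mono' measurableSet_Ioc hright
  rw [div_le_iff₀ (by positivity)] at hM
  rw [le_div_iff₀ (by positivity)] at hB
  have h2 : (0 : ℝ) ≤ g c ^ 2 - g c₁ ^ 2 := by nlinarith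
  have := mul_le_mul_of_nonneg_left hB h2
  have h3 := mul_le_mul_of_nonneg_left hM (sq_nonneg (g c₁))
  have h5 : (0 : ℝ) < 2 * m := by positivity
  refine le_of_mul_le_mul_left ?_ h5
  linarith

theorem inner_leftNormal_add_pi (θ : ℝ) (x : Plane) :
    inner ℝ (leftNormal (θ + Real.pi)) x = -inner ℝ (leftNormal θ) x := by
  simp [inner_leftNormal]; ring

theorem dir_add_pi (θ : ℝ) : dir (θ + Real.pi) = -dir θ := by
  ext i; fin_cases i <;> simp [dir]

theorem leftNormal_add_pi (θ : ℝ) : leftNormal (θ + Real.pi) = -leftNormal θ := by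
  ext i; fin_cases i <;> simp [leftNormal]

theorem slice_add_pi (θ c : ℝ) : slice K (θ + Real.pi) (-c) = -slice K θ c := by
  ext t
  simp [slice, dir_add_pi, leftNormal_add_pi]

theorem chordLength_add_pi (θ c : ℝ) :
    chordLength K (θ + Real.pi) (-c) = chordLength K θ c := by
  rw [chordLength_eq, chordLength_eq, slice_add_pi, Measure.measure_neg]

theorem area_halfPlane_add_opposite (hb : Bornology.IsBounded K) (θ c : ℝ) :
    area K ≤ area (K ∩ halfPlane θ c) + area (K ∩ halfPlane (θ + Real.pi) (-c)) := by
  have hsub : K ⊆ (K ∩ halfPlane θ c) ∪ (K ∩ halfPlane (θ + Real.pi) (-c)) := by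
    intro x hx
    rcases le_total (inner ℝ (leftNormal θ) x) c with h | h
    · exact Or.inl ⟨hx, h⟩
    · refine Or.inr ⟨hx, ?_⟩
      change inner ℝ (leftNormal (θ + Real.pi)) x ≤ -c
      rw [inner_leftNormal_add_pi]
      linarith
  rw [area, area, area, ← ENNReal.toReal_add
    (volume_ne_top (hb.subset inter_subset_left)) (volume_ne_top (hb.subset inter_subset_left))]
  exact ENNReal.toReal_mono (ENNReal.add_ne_top.2
    ⟨volume_ne_top (hb.subset inter_subset_left), volume_ne_top (hb.subset inter_subset_left)⟩)
    ((measure_mono hsub).trans (measure_union_le _ _))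

theorem capChord_exp_neg_one (h : 1 < area K) (θ : ℝ) :
    capChord K (Real.exp (-1)) θ = chordLength K θ (capLevel K 1 θ) := by
  rw [capChord, if_pos (Real.exp_lt_exp.2 (by linarith))]
  simp [Real.exp_neg]

/-- Every chord is controlled by the chord of the parallel cap of area `1`. -/
theorem chordLength_sq_le (hK : Convex ℝ K) (ho : IsOpen K) (hb : Bornology.IsBounded K)
    (h2 : 2 ≤ area K) (θ c : ℝ) :
    chordLength K θ c ^ 2 ≤
      2 * max 1 (area (K ∩ halfPlane θ c)) * capChord K (Real.exp (-1)) θ ^ 2 := by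
  rw [capChord_exp_neg_one (by linarith)]
  set c₁ := capLevel K 1 θ with hc1
  have ha : area (K ∩ halfPlane θ c₁) = 1 :=
    area_inter_halfPlane_capLevel ho.measurableSet hb θ zero_le_one (by linarith)
  obtain ⟨q, hq, hqc⟩ := slice_nonempty_of_area hK (θ := θ) (c := c₁) (by linarith) (by linarith)
  have hne : (slice K θ c₁).Nonempty := ⟨_, hqc ▸ mem_slice_of_mem hq θ⟩
  rcases le_total c₁ c with hle | hle
  · have := chordLength_sq_mul_area_le hK ho hb hle hne
    rw [ha, mul_one] at this
    have h3 : area (K ∩ halfPlane θ c) ≤ max 1 (area (K ∩ halfPlane θ c)) := le_max_right _ _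
    nlinarith [sq_nonneg (chordLength K θ c₁), le_max_left 1 (area (K ∩ halfPlane θ c))]
  · have hne' : (slice K (θ + Real.pi) (-c₁)).Nonempty := by
      rw [slice_add_pi]; exact hne.neg
    have := chordLength_sq_mul_area_le hK ho hb (neg_le_neg hle) hne'
    rw [chordLength_add_pi, chordLength_add_pi] at this
    have h3 := area_halfPlane_add_opposite hb θ c₁
    have h4 : area (K ∩ halfPlane (θ + Real.pi) (-c)) ≤ area K :=
      area_mono hb inter_subset_left
    have h5 : chordLength K θ c ^ 2 * (area K - 1) ≤ chordLength K θ c₁ ^ 2 * area K := by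
      refine le_trans (mul_le_mul_of_nonneg_left ?_ (sq_nonneg _))
        (this.trans (mul_le_mul_of_nonneg_left h4 (sq_nonneg _)))
      linarith
    have h6 : chordLength K θ c ^ 2 ≤ 2 * chordLength K θ c₁ ^ 2 := by
      have h7 : chordLength K θ c ^ 2 * (area K - 1) ≤
          2 * chordLength K θ c₁ ^ 2 * (area K - 1) := by
        nlinarith [mul_nonneg (sq_nonneg (chordLength K θ c₁)) (sub_nonneg.2 h2)]
      exact le_of_mul_le_mul_right h7 (by linarith)
    nlinarith [sq_nonneg (chordLength K θ c₁), le_max_left 1 (area (K ∩ halfPlane θ c))]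

/-! ### Area swept by a rotating chord -/

theorem mem_slice_ray {q : Plane} {φ s : ℝ} (h : q + s • dir φ ∈ K) :
    inner ℝ (dir φ) q + s ∈ slice K φ (inner ℝ (leftNormal φ) q) := by
  have := mem_slice_of_mem h φ
  simpa [inner_add_right, inner_smul_right, inner_leftNormal_dir, norm_dir] using this

/-- In polar coordinates around a point of `K`, a ray in direction `u(φ)` contributes at most the
square of the chord that contains it. -/
theorem lintegral_ray_le (hK : Convex ℝ K) (hb : Bornology.IsBounded K) {q : Plane} (hq : q ∈ K)
    (φ : ℝ) {S : Set Plane} (hS : S ⊆ K) :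
    ∫⁻ s in Ioi (0 : ℝ), ENNReal.ofReal s * S.indicator 1 (q + s • dir φ) ≤
      ENNReal.ofReal (chordLength K φ (inner ℝ (leftNormal φ) q) ^ 2) := by
  set l := chordLength K φ (inner ℝ (leftNormal φ) q)
  have hl : 0 ≤ l := chordLength_nonneg _ _
  calc ∫⁻ s in Ioi (0 : ℝ), ENNReal.ofReal s * S.indicator 1 (q + s • dir φ)
      = ∫⁻ s, (Ioi (0 : ℝ)).indicator
          (fun s => ENNReal.ofReal s * S.indicator 1 (q + s • dir φ)) s :=
        (lintegral_indicator measurableSet_Ioi _).symm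
    _ ≤ ∫⁻ s, (Ioc 0 l).indicator (fun _ => ENNReal.ofReal l) s := by
        refine lintegral_mono fun s => ?_
        by_cases hs : s ∈ Ioi (0 : ℝ)
        · rw [indicator_of_mem hs]
          by_cases hx : q + s • dir φ ∈ S
          · have hsl : s ≤ l := by
              have := sub_le_chordLength hK hb (mem_slice_of_mem hq φ) (mem_slice_ray (hS hx))
              linarith
            rw [indicator_of_mem hx, indicator_of_mem (show s ∈ Ioc 0 l from ⟨hs, hsl⟩)]
            simpa using ENNReal.ofReal_le_ofReal hsl
          · simp [indicator_of_notMem hx]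
        · simp [indicator_of_notMem hs]
    _ = ENNReal.ofReal (l ^ 2) := by
        rw [lintegral_indicator measurableSet_Ioc, setLIntegral_const, Real.volume_Ioc, sub_zero,
          ← ENNReal.ofReal_mul hl, sq]

/-- The part of `K` in a wedge with apex `q ∈ K` is swept by the chords through `q`. -/
theorem volume_wedge_le (hK : Convex ℝ K) (ho : IsOpen K) (hb : Bornology.IsBounded K)
    {q : Plane} (hq : q ∈ K) {α β : ℝ} (hαβ : α ≤ β) :
    volume {x ∈ K | 0 ≤ inner ℝ (leftNormal α) (x - q) ∧
        inner ℝ (leftNormal β) (x - q) ≤ 0} ≤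
      ∫⁻ φ in Icc α β,
        ENNReal.ofReal (chordLength K φ (inner ℝ (leftNormal φ) q) ^ 2) := by
  set S := {x ∈ K | 0 ≤ inner ℝ (leftNormal α) (x - q) ∧
        inner ℝ (leftNormal β) (x - q) ≤ 0} with hSdef
  set F : ℝ → ℝ≥0∞ := fun φ =>
    ENNReal.ofReal (chordLength K φ (inner ℝ (leftNormal φ) q) ^ 2) with hF
  have hSK : S ⊆ K := sep_subset _ _
  have hn : ∀ θ : ℝ, Measurable fun x : Plane => inner ℝ (leftNormal θ) (x - q) := by
    intro θ; fun_prop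
  have hS : MeasurableSet S :=
    ho.measurableSet.inter ((measurableSet_le measurable_const (hn α)).inter
      (measurableSet_le (hn β) measurable_const))
  have hmp : MeasurePreserving (fun p : ℝ × ℝ => q + (p.1 • dir α + p.2 • leftNormal α)) :=
    (measurePreserving_add_left volume q).comp (measurePreserving_frame α)
  have hind : Measurable (S.indicator (1 : Plane → ℝ≥0∞)) := measurable_one.indicator hS
  have hpolar : ∀ s ψ : ℝ, q + ((polarCoord.symm (s, ψ)).1 • dir α +
      (polarCoord.symm (s, ψ)).2 • leftNormal α) = q + s • dir (α + ψ) := by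
    intro s ψ
    rw [← cos_smul_dir_add_sin_smul_leftNormal]
    simp only [polarCoord_symm_apply]
    module
  calc volume S = ∫⁻ x, S.indicator 1 x := (lintegral_indicator_one hS).symm
    _ = ∫⁻ p : ℝ × ℝ, S.indicator 1 (q + (p.1 • dir α + p.2 • leftNormal α)) :=
        (hmp.lintegral_comp hind).symm
    _ = ∫⁻ p in polarCoord.target, ENNReal.ofReal p.1 •
          S.indicator 1 (q + ((polarCoord.symm p).1 • dir α +
            (polarCoord.symm p).2 • leftNormal α)) :=
        (lintegral_comp_polarCoord_symm _).symm
    _ = ∫⁻ p in Ioi (0 : ℝ) ×ˢ Ioo (-Real.pi) Real.pi, ENNReal.ofReal p.1 *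
          S.indicator 1 (q + p.1 • dir (α + p.2)) := by
        rw [polarCoord_target]
        refine lintegral_congr fun p => ?_
        rw [hpolar p.1 p.2, smul_eq_mul]
    _ = ∫⁻ ψ in Ioo (-Real.pi) Real.pi, ∫⁻ s in Ioi (0 : ℝ), ENNReal.ofReal s *
          S.indicator 1 (q + s • dir (α + ψ)) := by
        rw [Measure.volume_eq_prod, ← Measure.prod_restrict]
        refine lintegral_prod_symm _ (Measurable.aemeasurable ?_)
        refine Measurable.mul (by fun_prop) (hind.comp (Continuous.measurable ?_))
        have : Continuous dir := by unfold dir; fun_prop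
        fun_prop
    _ ≤ ∫⁻ ψ in Ioo (-Real.pi) Real.pi, (Icc α β).indicator F (α + ψ) := by
        refine setLIntegral_mono' measurableSet_Ioo fun ψ hψ => ?_
        by_cases h : α + ψ ∈ Icc α β
        · rw [indicator_of_mem h]
          exact lintegral_ray_le hK hb hq _ hSK
        · rw [indicator_of_notMem h, nonpos_iff_eq_zero]
          refine setLIntegral_eq_zero measurableSet_Ioi fun s hs => ?_
          have hs : 0 < s := hs
          have : q + s • dir (α + ψ) ∉ S := by
            rintro ⟨-, h1, h2⟩
            rw [add_sub_cancel_left, inner_smul_right, inner_leftNormal_dir] at h1 h2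
            have h1' := nonneg_of_mul_nonneg_right h1 hs
            have h2' : Real.sin (α + ψ - β) ≤ 0 := by
              by_contra! hc
              nlinarith [mul_pos hs hc]
            rw [add_sub_cancel_left] at h1'
            have hψ0 : 0 ≤ ψ := by
              by_contra! hc
              linarith [Real.sin_neg_of_neg_of_neg_pi_lt hc hψ.1]
            refine h ⟨by linarith, ?_⟩
            by_contra! hc
            linarith [Real.sin_pos_of_pos_of_lt_pi (x := α + ψ - β) (by linarith)
              (by linarith [hψ.2])]
          simp [indicator_of_notMem this]
    _ ≤ ∫⁻ ψ, (Icc α β).indicator F (α + ψ) := setLIntegral_le_lintegral _ _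
    _ = ∫⁻ φ, (Icc α β).indicator F φ := lintegral_add_left_eq_self _ α
    _ = ∫⁻ φ in Icc α β, F φ := lintegral_indicator measurableSet_Icc _

theorem volume_opposite_wedge_le (hK : Convex ℝ K) (ho : IsOpen K) (hb : Bornology.IsBounded K)
    {q : Plane} (hq : q ∈ K) {α β : ℝ} (hαβ : α ≤ β) :
    volume {x ∈ K | inner ℝ (leftNormal α) (x - q) ≤ 0 ∧
        0 ≤ inner ℝ (leftNormal β) (x - q)} ≤
      ∫⁻ φ in Icc α β,
        ENNReal.ofReal (chordLength K φ (inner ℝ (leftNormal φ) q) ^ 2) := by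
  have h := volume_wedge_le hK ho hb hq (add_le_add_left hαβ Real.pi)
  simp only [inner_leftNormal_add_pi, Left.nonneg_neg_iff, Left.neg_nonpos_iff] at h
  refine h.trans (le_of_eq ?_)
  rw [← lintegral_indicator measurableSet_Icc, ← lintegral_indicator measurableSet_Icc,
    ← lintegral_add_right_eq_self _ Real.pi]
  refine lintegral_congr fun φ => ?_
  by_cases hφ : φ ∈ Icc α β
  · rw [indicator_of_mem hφ, indicator_of_mem (by simpa using hφ), inner_leftNormal_add_pi,
      chordLength_add_pi]
  · rw [indicator_of_notMem hφ, indicator_of_notMem (by simpa using hφ)]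

/-! ### Caps at nearby angles overlap -/

/-- The intersection of the half-planes at angles `α` and `β` to the right of the lines
through `q`. -/
def capInter (α β : ℝ) (q : Plane) : Set Plane :=
  halfPlane α (inner ℝ (leftNormal α) q) ∩ halfPlane β (inner ℝ (leftNormal β) q)

/-- The union of the half-planes at angles `α` and `β` to the right of the lines through `q`. -/
def capUnion (α β : ℝ) (q : Plane) : Set Plane :=
  halfPlane α (inner ℝ (leftNormal α) q) ∪ halfPlane β (inner ℝ (leftNormal β) q)

theorem mem_halfPlane_inner {θ : ℝ} {q x : Plane} :
    x ∈ halfPlane θ (inner ℝ (leftNormal θ) q) ↔ inner ℝ (leftNormal θ) (x - q) ≤ 0 := by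
  rw [inner_sub_right, sub_nonpos]; rfl

theorem area_le_add {S T U : Set Plane} (hT : volume T ≠ ∞) (hU : volume U ≠ ∞) (h : S ⊆ T ∪ U) :
    area S ≤ area T + area U := by
  rw [area, area, area, ← ENNReal.toReal_add hT hU]
  exact ENNReal.toReal_mono (ENNReal.add_ne_top.2 ⟨hT, hU⟩)
    ((measure_mono h).trans (measure_union_le _ _))

/-- If the arc `[α, β]` has small measure, then rotating the line that bounds a cap of area at
least `1` through the arc changes the cap little. The area `w` newly covered is at most the
integral of the squares of the chords through `q`, each of which bounds a cap of area at most
`r + w`; so `w ≤ 2 (r + w) μ`. -/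
theorem area_capInter_capUnion (hK : Convex ℝ K) (ho : IsOpen K) (hb : Bornology.IsBounded K)
    (h2 : 2 ≤ area K) {q : Plane} (hq : q ∈ K) {α β : ℝ} (hαβ : α ≤ β) (hβ : β < α + Real.pi)
    (hμ : affineMeasure K (Icc α β) ≤ ENNReal.ofReal (1 / 6)) {r : ℝ} (hr : 1 ≤ r)
    (hcap : area (K ∩ halfPlane α (inner ℝ (leftNormal α) q)) = r) :
    r / 2 ≤ area (K ∩ capInter α β q) ∧ area (K ∩ capUnion α β q) ≤ 2 * r := by
  set W := {x ∈ K | 0 ≤ inner ℝ (leftNormal α) (x - q) ∧ inner ℝ (leftNormal β) (x - q) ≤ 0}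
    with hW
  set V := {x ∈ K | inner ℝ (leftNormal α) (x - q) ≤ 0 ∧ 0 ≤ inner ℝ (leftNormal β) (x - q)}
    with hV
  have hWt : volume W ≠ ∞ := volume_ne_top (hb.subset (sep_subset _ _))
  have hVt : volume V ≠ ∞ := volume_ne_top (hb.subset (sep_subset _ _))
  have hCt : ∀ S : Set Plane, volume (K ∩ S) ≠ ∞ := fun S =>
    volume_ne_top (hb.subset inter_subset_left)
  set w := area W
  have hw0 : 0 ≤ w := area_nonneg _
  have hU : area (K ∩ capUnion α β q) ≤ r + w := by
    rw [← hcap]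
    refine area_le_add (hCt _) hWt ?_
    rintro x ⟨hx, hx1 | hx1⟩
    · exact Or.inl ⟨hx, hx1⟩
    · rcases le_total (inner ℝ (leftNormal α) (x - q)) 0 with h | h
      · exact Or.inl ⟨hx, mem_halfPlane_inner.2 h⟩
      · exact Or.inr ⟨hx, h, mem_halfPlane_inner.1 hx1⟩
  have hI : r ≤ area (K ∩ capInter α β q) + area V := by
    rw [← hcap]
    refine area_le_add (hCt _) hVt ?_
    rintro x ⟨hx, hx1⟩
    rcases le_total (inner ℝ (leftNormal β) (x - q)) 0 with h | h
    · exact Or.inl ⟨hx, hx1, mem_halfPlane_inner.2 h⟩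
    · exact Or.inr ⟨hx, mem_halfPlane_inner.1 hx1, h⟩
  have hint : ∫⁻ φ in Icc α β,
      ENNReal.ofReal (chordLength K φ (inner ℝ (leftNormal φ) q) ^ 2) ≤
      ENNReal.ofReal ((r + w) / 3) := by
    calc _ ≤ ∫⁻ φ in Icc α β, ENNReal.ofReal (2 * (r + w)) *
          ENNReal.ofReal (capChord K (Real.exp (-1)) φ ^ 2) := by
          refine setLIntegral_mono' measurableSet_Icc fun φ hφ => ?_
          rw [← ENNReal.ofReal_mul (by positivity)]
          refine ENNReal.ofReal_le_ofReal ((chordLength_sq_le hK ho hb h2 φ _).trans ?_)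
          refine mul_le_mul_of_nonneg_right ?_ (sq_nonneg _)
          refine mul_le_mul_of_nonneg_left (max_le (by linarith) (le_trans ?_ hU)) zero_le_two
          refine area_mono (hb.subset inter_subset_left) (inter_subset_inter_right K fun x hx => ?_)
          by_contra hc
          simp only [capUnion, mem_union, mem_halfPlane_inner, not_or, not_le] at hc hx
          exact absurd hx (not_le.2 (inner_leftNormal_pos_of_mem_Icc hφ hβ hc.1 hc.2))
      _ = ENNReal.ofReal (2 * (r + w)) * affineMeasure K (Icc α β) := by
          rw [lintegral_const_mul' _ _ ENNReal.ofReal_ne_top, affineMeasure,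
            withDensity_apply _ measurableSet_Icc]
      _ ≤ ENNReal.ofReal (2 * (r + w)) * ENNReal.ofReal (1 / 6) := by gcongr
      _ = _ := by
          rw [← ENNReal.ofReal_mul (by positivity)]
          congr 1; ring
  have hw : w ≤ (r + w) / 3 := ENNReal.toReal_le_of_le_ofReal (by positivity)
    ((volume_wedge_le hK ho hb hq hαβ).trans hint)
  have hv : area V ≤ (r + w) / 3 := ENNReal.toReal_le_of_le_ofReal (by positivity)
    ((volume_opposite_wedge_le hK ho hb hq hαβ).trans hint)
  constructor <;> linarith

/-! ### The Laplace functional of the Poisson process -/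

theorem measurable_config {γ : Type*} [MeasurableSpace γ] {f : Config → γ}
    (h : ∀ n : ℕ, Measurable fun x : Fin n → Plane => f ⟨n, x⟩) : Measurable f := by
  intro s hs
  rw [MeasurableSpace.measurableSet_iInf]
  exact fun n => h n hs

theorem measurable_config_mk (n : ℕ) : Measurable fun x : Fin n → Plane => (⟨n, x⟩ : Config) := by
  intro s hs
  exact (MeasurableSpace.measurableSet_iInf.1 hs) n

theorem lintegral_poissonLaw {F : Config → ℝ≥0∞} (hF : Measurable F) :
    ∫⁻ ω, F ω ∂poissonLaw K = ∑' n : ℕ, ENNReal.ofReal (Real.exp (-area K) / (n.factorial : ℝ)) *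
      ∫⁻ x, F ⟨n, x⟩ ∂(Measure.pi fun _ : Fin n => (volume.restrict K : Measure Plane)) := by
  rw [poissonLaw, lintegral_sum_measure]
  refine tsum_congr fun n => ?_
  rw [lintegral_smul_measure, lintegral_map hF (measurable_config_mk n), smul_eq_mul]

theorem lintegral_pi_prod {X : Type*} [MeasurableSpace X] (ν : Measure X) [SigmaFinite ν]
    {g : X → ℝ≥0∞} (hg : Measurable g) (n : ℕ) :
    ∫⁻ x, ∏ i, g (x i) ∂(Measure.pi fun _ : Fin n => ν) = (∫⁻ x, g x ∂ν) ^ n := by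
  induction n with
  | zero => simp
  | succ n ih =>
    have hmp := (measurePreserving_piFinSuccAbove (fun _ : Fin (n + 1) => ν) 0).symm
    rw [← hmp.lintegral_comp (by fun_prop)]
    simp only [Fin.prod_univ_succ]
    have e : ∀ p : X × (Fin n → X),
        g ((MeasurableEquiv.piFinSuccAbove (fun _ : Fin (n + 1) => X) 0).symm p 0) *
          ∏ i : Fin n, g ((MeasurableEquiv.piFinSuccAbove (fun _ : Fin (n + 1) => X) 0).symm p
            i.succ) = g p.1 * ∏ i : Fin n, g (p.2 i) := by
      intro p
      simp [MeasurableEquiv.piFinSuccAbove, Fin.insertNthEquiv]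
    simp only [e]
    have hg' : Measurable fun y : Fin n → X => ∏ i, g (y i) :=
      Finset.measurable_fun_prod _ fun i _ => hg.comp (measurable_pi_apply i)
    rw [lintegral_prod_mul (f := g) (g := fun y : Fin n → X => ∏ i, g (y i)) hg.aemeasurable
      hg'.aemeasurable, ih, pow_succ, mul_comm]

/-- The expectation of `∏ g(xᵢ)` over a Poisson process in `K` is `exp (∫_K (g - 1))`. -/
theorem lintegral_poissonLaw_prod_le (hb : Bornology.IsBounded K) {g : Plane → ℝ≥0∞}
    (hg : Measurable g) {G : ℝ} (hG : 0 ≤ G) (h : ∫⁻ x in K, g x ≤ ENNReal.ofReal G) :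
    ∫⁻ ω, ∏ i, g (ω.2 i) ∂poissonLaw K ≤ ENNReal.ofReal (Real.exp (G - area K)) := by
  have : IsFiniteMeasure (volume.restrict K : Measure Plane) :=
    ⟨by simpa using hb.measure_lt_top⟩
  have hprod : Measurable fun ω : Config => ∏ i, g (ω.2 i) := measurable_config fun n =>
    show Measurable fun x : Fin n → Plane => ∏ i, g (x i) from
      Finset.measurable_fun_prod _ fun i _ => hg.comp (measurable_pi_apply i)
  rw [lintegral_poissonLaw hprod]
  have hs : HasSum (fun n : ℕ => Real.exp (-area K) / (n.factorial : ℝ) * G ^ n)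
      (Real.exp (G - area K)) := by
    have h1 := (NormedSpace.expSeries_div_hasSum_exp (𝔸 := ℝ) G).mul_left (Real.exp (-area K))
    rw [← Real.exp_eq_exp_ℝ, ← Real.exp_add, neg_add_eq_sub] at h1
    exact h1.congr_fun fun n => by ring
  rw [← hs.tsum_eq, ENNReal.ofReal_tsum_of_nonneg (fun n => by positivity) hs.summable]
  refine ENNReal.tsum_le_tsum fun n => ?_
  rw [lintegral_pi_prod _ hg, ENNReal.ofReal_mul (by positivity), ENNReal.ofReal_pow hG]
  gcongr

/-- The number of points of a configuration in a set. -/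
noncomputable def pointCount (D : Set Plane) (ω : Config) : ℝ :=
  ∑ i, D.indicator (fun _ => (1 : ℝ)) (ω.2 i)

theorem measurable_pointCount {D : Set Plane} (hD : MeasurableSet D) :
    Measurable (pointCount D) := by
  refine measurable_config fun n => ?_
  have h1 : Measurable (D.indicator (fun _ => (1 : ℝ))) := measurable_const.indicator hD
  change Measurable fun x : Fin n → Plane => ∑ i, D.indicator (fun _ => (1 : ℝ)) (x i)
  exact Finset.measurable_fun_sum _ fun i _ => h1.comp (measurable_pi_apply i)

open Classical in
/-- The exponential moment of the number of points in `D` on the event that `O` contains no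
points. -/
theorem lintegral_avoid_exp_le (hb : Bornology.IsBounded K) {O D : Set Plane}
    (hO : MeasurableSet O) (hD : MeasurableSet D) {ε : ℝ} (hε : 0 ≤ ε) :
    ∫⁻ ω, (if ∀ i, ω.2 i ∉ O then ENNReal.ofReal (Real.exp (ε * pointCount D ω)) else 0)
      ∂poissonLaw K ≤
      ENNReal.ofReal (Real.exp ((Real.exp ε - 1) * area (K ∩ D) - area (K ∩ O))) := by
  set g : Plane → ℝ≥0∞ := fun x =>
    Oᶜ.indicator (fun x => ENNReal.ofReal (Real.exp (ε * D.indicator (fun _ => (1 : ℝ)) x))) x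
    with hgdef
  have hg : Measurable g := by
    refine Measurable.indicator ?_ hO.compl
    have : Measurable (D.indicator (fun _ => (1 : ℝ))) := measurable_const.indicator hD
    fun_prop
  have he : (0 : ℝ) ≤ Real.exp ε - 1 := by linarith [Real.add_one_le_exp ε]
  have heq : ∀ ω : Config, (if ∀ i, ω.2 i ∉ O then
      ENNReal.ofReal (Real.exp (ε * pointCount D ω)) else 0) = ∏ i, g (ω.2 i) := by
    intro ω
    split_ifs with h
    · rw [pointCount, Finset.mul_sum, Real.exp_sum,
        ENNReal.ofReal_prod_of_nonneg fun i _ => (Real.exp_pos _).le]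
      exact Finset.prod_congr rfl fun i _ => by rw [hgdef]; simp [h i]
    · push Not at h
      obtain ⟨i, hi⟩ := h
      exact (Finset.prod_eq_zero (Finset.mem_univ i) (by simp [hgdef, hi])).symm
  have hOK : area (K ∩ O) ≤ area K := area_mono hb inter_subset_left
  have hint : ∫⁻ x in K, g x ≤
      ENNReal.ofReal (area K - area (K ∩ O) + (Real.exp ε - 1) * area (K ∩ D)) := by
    have hpt : ∀ x, g x ≤ Oᶜ.indicator 1 x + ENNReal.ofReal (Real.exp ε - 1) * D.indicator 1 x := by
      intro x
      by_cases hx : x ∈ O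
      · simp [hgdef, hx]
      · by_cases hxD : x ∈ D
        · have : ENNReal.ofReal (Real.exp ε) = 1 + ENNReal.ofReal (Real.exp ε - 1) := by
            rw [← ENNReal.ofReal_one, ← ENNReal.ofReal_add zero_le_one he]
            congr 1; ring
          simp [hgdef, hx, hxD, this]
        · simp [hgdef, hx, hxD]
    calc ∫⁻ x in K, g x
        ≤ ∫⁻ x in K, (Oᶜ.indicator 1 x + ENNReal.ofReal (Real.exp ε - 1) * D.indicator 1 x) :=
          lintegral_mono hpt
      _ = volume.restrict K Oᶜ + ENNReal.ofReal (Real.exp ε - 1) * volume.restrict K D := by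
          rw [lintegral_add_left (measurable_one.indicator hO.compl),
            lintegral_const_mul _ (measurable_one.indicator hD), lintegral_indicator_one hO.compl,
            lintegral_indicator_one hD]
      _ = ENNReal.ofReal (area K - area (K ∩ O)) +
            ENNReal.ofReal (Real.exp ε - 1) * ENNReal.ofReal (area (K ∩ D)) := by
          have : IsFiniteMeasure (volume.restrict K : Measure Plane) :=
            ⟨by simpa using hb.measure_lt_top⟩
          rw [ofReal_area (hb.subset inter_subset_left), Measure.restrict_apply hD,
            inter_comm D K, measure_compl hO (measure_ne_top _ _), Measure.restrict_apply_univ,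
            Measure.restrict_apply hO, ENNReal.ofReal_sub _ (area_nonneg _), ofReal_area hb,
            ofReal_area (hb.subset inter_subset_left), inter_comm O K]
      _ = _ := by
          rw [← ENNReal.ofReal_mul he, ← ENNReal.ofReal_add (by linarith)
            (mul_nonneg he (area_nonneg _))]
  simp only [heq]
  refine (lintegral_poissonLaw_prod_le hb hg ?_ hint).trans (le_of_eq ?_)
  · have := mul_nonneg he (area_nonneg (K ∩ D))
    linarith
  · congr 2; ring

/-- The exponential rate for which the local functionals have bounded exponential moments. It is
small enough that the expected growth of the functional from one scale to the next is outweighed by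
the decay of the probability that the smaller scale contains no point. -/
noncomputable def localRate : ℝ := 1 / 24

/-- The bound on the exponential moments of the local functionals at the rate `localRate`. -/
noncomputable def momentBound : ℝ := Real.exp (1 / 4) * (1 - Real.exp (-(1 / 4)))⁻¹

theorem momentBound_nonneg : 0 ≤ momentBound := by
  have : Real.exp (-(1 / 4)) < 1 := Real.exp_lt_one_iff.2 (by norm_num)
  exact mul_nonneg (Real.exp_pos _).le (inv_nonneg.2 (by linarith))

open Classical in
/-- A functional has a bounded exponential moment if it is controlled by the number of points in
`D (k + 1)`, where `k` is such that there are no points in `O k`: the probability of the latter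
decays exponentially in `k`. -/
theorem lintegral_exp_le_of_exists_scale (hb : Bornology.IsBounded K) {X : Config → ℝ} (N : ℕ)
    {O D : ℕ → Set Plane} (hOm : ∀ k, MeasurableSet (O k)) (hDm : ∀ k, MeasurableSet (D k))
    (hO : ∀ k ≤ N, (k : ℝ) / 2 ≤ area (K ∩ O k))
    (hD : ∀ k ≤ N, area (K ∩ D (k + 1)) ≤ 2 * (k + 1))
    (hX : ∀ ω : Config, ∃ k ≤ N, (∀ i, ω.2 i ∉ O k) ∧
      X ω ≤ 2 * (k + 1) + pointCount (D (k + 1)) ω) :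
    ∫⁻ ω, ENNReal.ofReal (Real.exp (localRate * X ω)) ∂poissonLaw K ≤
      ENNReal.ofReal momentBound := by
  have hr0 : (0 : ℝ) ≤ localRate := by norm_num [localRate]
  have hexp : Real.exp localRate - 1 ≤ 1 / 12 := by
    have := Real.abs_exp_sub_one_le (x := localRate) (by norm_num [localRate, abs_le])
    rw [abs_of_nonneg hr0] at this
    refine (le_abs_self _).trans (this.trans ?_)
    norm_num [localRate]
  have hexp0 : 0 ≤ Real.exp localRate - 1 := by linarith [Real.add_one_le_exp localRate]
  set T : ℕ → Config → ℝ≥0∞ := fun k ω => ENNReal.ofReal (Real.exp ((k + 1) / 12)) *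
    (if ∀ i, ω.2 i ∉ O k then ENNReal.ofReal (Real.exp (localRate * pointCount (D (k + 1)) ω))
      else 0) with hT
  have hpt : ∀ ω, ENNReal.ofReal (Real.exp (localRate * X ω)) ≤
      ∑ k ∈ Finset.range (N + 1), T k ω := by
    intro ω
    obtain ⟨k, hk, hav, hXk⟩ := hX ω
    refine le_trans ?_ (Finset.single_le_sum (f := fun k => T k ω) (fun _ _ => zero_le)
      (Finset.mem_range.2 (Nat.lt_succ_of_le hk)))
    simp only [hT]
    rw [if_pos hav, ← ENNReal.ofReal_mul (Real.exp_pos _).le, ← Real.exp_add]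
    refine ENNReal.ofReal_le_ofReal (Real.exp_le_exp.2 ?_)
    refine (mul_le_mul_of_nonneg_left hXk hr0).trans (le_of_eq ?_)
    rw [localRate]; ring
  have hterm : ∀ k ∈ Finset.range (N + 1), ∫⁻ ω, T k ω ∂poissonLaw K ≤
      ENNReal.ofReal (Real.exp (1 / 4) * Real.exp (-(1 / 4)) ^ k) := by
    intro k hk
    have hk : k ≤ N := Nat.lt_succ_iff.1 (Finset.mem_range.1 hk)
    simp only [hT]
    rw [lintegral_const_mul' _ _ ENNReal.ofReal_ne_top]
    calc _ ≤ ENNReal.ofReal (Real.exp ((k + 1) / 12)) * ENNReal.ofReal (Real.exp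
          ((Real.exp localRate - 1) * area (K ∩ D (k + 1)) - area (K ∩ O k))) := by
          gcongr
          exact lintegral_avoid_exp_le hb (hOm k) (hDm _) hr0
      _ ≤ _ := by
          rw [← ENNReal.ofReal_mul (Real.exp_pos _).le, ← Real.exp_add, ← Real.exp_nat_mul,
            ← Real.exp_add]
          refine ENNReal.ofReal_le_ofReal (Real.exp_le_exp.2 ?_)
          have h1 := hO k hk
          have h2 : (Real.exp localRate - 1) * area (K ∩ D (k + 1)) ≤ 1 / 12 * (2 * (k + 1)) :=
            mul_le_mul hexp (hD k hk) (area_nonneg _) (by norm_num)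
          linarith
  have hmeas : ∀ k ∈ Finset.range (N + 1), Measurable (T k) := by
    intro k _
    refine measurable_const.mul (measurable_config fun n => Measurable.ite ?_ ?_ measurable_const)
    · have : {x : Fin n → Plane | ∀ i, x i ∉ O k} = ⋂ i, {x | x i ∉ O k} := by ext; simp
      rw [this]
      exact MeasurableSet.iInter fun i => (hOm k).compl.preimage (measurable_pi_apply i)
    · have h2 := (measurable_pointCount (hDm (k + 1))).comp (measurable_config_mk n)
      exact (Real.measurable_exp.comp (h2.const_mul localRate)).ennreal_ofReal
  have hlt : Real.exp (-(1 / 4)) < 1 := Real.exp_lt_one_iff.2 (by norm_num)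
  calc ∫⁻ ω, ENNReal.ofReal (Real.exp (localRate * X ω)) ∂poissonLaw K
      ≤ ∫⁻ ω, ∑ k ∈ Finset.range (N + 1), T k ω ∂poissonLaw K := lintegral_mono hpt
    _ = ∑ k ∈ Finset.range (N + 1), ∫⁻ ω, T k ω ∂poissonLaw K := lintegral_finsetSum _ hmeas
    _ ≤ ∑ k ∈ Finset.range (N + 1),
          ENNReal.ofReal (Real.exp (1 / 4) * Real.exp (-(1 / 4)) ^ k) := Finset.sum_le_sum hterm
    _ = ENNReal.ofReal (∑ k ∈ Finset.range (N + 1), Real.exp (1 / 4) * Real.exp (-(1 / 4)) ^ k) :=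
        (ENNReal.ofReal_sum_of_nonneg fun k _ => by positivity).symm
    _ ≤ ENNReal.ofReal momentBound := by
        refine ENNReal.ofReal_le_ofReal ?_
        rw [← Finset.mul_sum, momentBound, ← tsum_geometric_of_lt_one (Real.exp_pos _).le hlt]
        gcongr
        exact (summable_geometric_of_lt_one (Real.exp_pos _).le hlt).sum_le_tsum _
          fun k _ => by positivity

/-- A functional has a bounded exponential moment if it is controlled by the number of points in
`D k` as soon as there is a point in `O k`, for all `k` up to the area of `K`. -/
theorem lintegral_exp_le_of_scales (hb : Bornology.IsBounded K) {X : Config → ℝ} (N : ℕ)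
    (hN : area K ≤ 2 * (N + 1))
    {O D : ℕ → Set Plane} (hOm : ∀ k, MeasurableSet (O k)) (hDm : ∀ k, MeasurableSet (D k))
    (hO : ∀ k, 1 ≤ k → k ≤ N → (k : ℝ) / 2 ≤ area (K ∩ O k))
    (hD : ∀ k, 1 ≤ k → k ≤ N → area (K ∩ D k) ≤ 2 * k)
    (hX : ∀ k, 1 ≤ k → k ≤ N → ∀ ω : Config, (∃ i, ω.2 i ∈ O k) →
      X ω ≤ 2 * k + pointCount (D k) ω)
    (hX' : ∀ ω : Config, X ω ≤ 2 * (N + 1) + pointCount univ ω) :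
    ∫⁻ ω, ENNReal.ofReal (Real.exp (localRate * X ω)) ∂poissonLaw K ≤
      ENNReal.ofReal momentBound := by
  classical
  refine lintegral_exp_le_of_exists_scale hb N (O := fun k => if k = 0 then ∅ else O k)
    (D := fun k => if k ≤ N then D k else univ) ?_ ?_ ?_ ?_ ?_
  · intro k; split_ifs
    exacts [MeasurableSet.empty, hOm k]
  · intro k; split_ifs
    exacts [hDm k, MeasurableSet.univ]
  · intro k hk; split_ifs with h
    · simp [h, area]
    · exact hO k (Nat.one_le_iff_ne_zero.2 h) hk
  · intro k hk; split_ifs with h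
    · exact_mod_cast hD (k + 1) (by omega) h
    · have : k = N := by omega
      rw [inter_univ, this]
      exact hN
  · intro ω
    -- The largest scale `k` at which there is no point in `O k`.
    set P : ℕ → Prop := fun k => ∀ i, ω.2 i ∉ (if k = 0 then ∅ else O k) with hP
    have hP0 : P 0 := by simp [hP]
    refine ⟨Nat.findGreatest P N, Nat.findGreatest_le N,
      Nat.findGreatest_spec (Nat.zero_le N) hP0, ?_⟩
    set k := Nat.findGreatest P N with hk
    have hkN : k ≤ N := Nat.findGreatest_le N
    split_ifs with h
    · have hnot : ¬ P (k + 1) := Nat.findGreatest_is_greatest (Nat.lt_succ_self k) h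
      simp only [hP, Nat.add_eq_zero_iff, one_ne_zero, and_false, if_false] at hnot
      push Not at hnot
      exact_mod_cast hX (k + 1) (by omega) h ω hnot
    · have : k = N := by omega
      rw [this]
      exact hX' ω

/-! ### Vertices, edges and tangent rays of the polygon -/

theorem mem_polygon (ω : Config) (i : Fin ω.1) : ω.2 i ∈ polygon ω :=
  subset_convexHull ℝ _ (mem_range_self i)

theorem polygon_nonempty_iff (ω : Config) : (polygon ω).Nonempty ↔ 0 < ω.1 := by
  rw [polygon, convexHull_nonempty_iff, range_nonempty_iff_nonempty, ← Fin.pos_iff_nonempty]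

theorem mem_face_iff {ω : Config} {θ : ℝ} {w : Plane} :
    w ∈ face (polygon ω) θ ↔ w ∈ polygon ω ∧
      ∀ i, inner ℝ (leftNormal θ) w ≤ inner ℝ (leftNormal θ) (ω.2 i) := by
  refine and_congr_right fun _ => ⟨fun h i => h _ (mem_polygon ω i), fun h => ?_⟩
  have hconv : Convex ℝ {y : Plane | inner ℝ (leftNormal θ) w ≤ inner ℝ (leftNormal θ) y} :=
    convex_halfSpace_ge (innerₛₗ ℝ (leftNormal θ)).isLinear _
  have hsub : range ω.2 ⊆ {y : Plane | inner ℝ (leftNormal θ) w ≤ inner ℝ (leftNormal θ) y} :=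
    range_subset_iff.2 h
  exact fun y hy => convexHull_min hsub hconv hy

/-- A lexicographic minimum over the polygon is attained at one of the points. -/
theorem exists_lex_min (ω : Config) (hω : 0 < ω.1) (a b : Plane) :
    ∃ i, ∀ y ∈ polygon ω, inner ℝ a (ω.2 i) ≤ inner ℝ a y ∧
      (inner ℝ a y = inner ℝ a (ω.2 i) → inner ℝ b (ω.2 i) ≤ inner ℝ b y) := by
  have : Nonempty (Fin ω.1) := Fin.pos_iff_nonempty.1 hω
  obtain ⟨i, hi⟩ := Finite.exists_min
    fun i => toLex ((inner ℝ a (ω.2 i) : ℝ), (inner ℝ b (ω.2 i) : ℝ))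
  set w := ω.2 i
  have hconv : Convex ℝ {y : Plane | inner ℝ a w < inner ℝ a y ∨
      (inner ℝ a w = inner ℝ a y ∧ inner ℝ b w ≤ inner ℝ b y)} := by
    intro y hy z hz s t hs ht hst
    simp only [mem_ofPred_eq, inner_add_right, inner_smul_right] at hy hz ⊢
    have hsa : ∀ c : ℝ, c = s * c + t * c := fun c => by rw [← add_mul, hst, one_mul]
    rcases hs.eq_or_lt with rfl | hs
    · obtain rfl : t = 1 := by linarith
      simpa using hz
    rcases ht.eq_or_lt with rfl | ht
    · obtain rfl : s = 1 := by linarith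
      simpa using hy
    rcases hy with hy | ⟨hy, hy'⟩ <;> rcases hz with hz | ⟨hz, hz'⟩
    · left; rw [hsa (inner ℝ a w)]
      linarith [mul_lt_mul_of_pos_left hy hs, mul_lt_mul_of_pos_left hz ht]
    · left; rw [hsa (inner ℝ a w), ← hz]
      linarith [mul_lt_mul_of_pos_left hy hs]
    · left; rw [hsa (inner ℝ a w), ← hy]
      linarith [mul_lt_mul_of_pos_left hz ht]
    · right
      rw [← hy, ← hz, ← hsa]
      refine ⟨rfl, ?_⟩
      rw [hsa (inner ℝ b w)]
      linarith [mul_le_mul_of_nonneg_left hy' hs.le, mul_le_mul_of_nonneg_left hz' ht.le]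
  refine ⟨i, fun y hy => ?_⟩
  have hy' := convexHull_min (range_subset_iff.2 fun j => ?_) hconv hy
  · rcases hy' with h | ⟨h, h'⟩
    · exact ⟨h.le, fun h2 => absurd h2 h.ne'⟩
    · exact ⟨h.le, fun _ => h'⟩
  · exact Prod.Lex.toLex_le_toLex.1 (hi j)

theorem eq_add_smul_dir_of_inner_eq {θ : ℝ} {x y : Plane}
    (h : inner ℝ (leftNormal θ) x = inner ℝ (leftNormal θ) y) :
    y = x + (inner ℝ (dir θ) y - inner ℝ (dir θ) x : ℝ) • dir θ := by
  have h1 := frame_decomp θ (y - x)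
  rw [inner_sub_right, inner_sub_right, h, sub_self, zero_smul, zero_add] at h1
  rw [h1]; abel

/-- The initial point of the face at angle `θ` is one of the points of the configuration. -/
theorem exists_first_vertex (ω : Config) (hω : 0 < ω.1) (θ : ℝ) :
    ∃ i, ω.2 i ∈ face (polygon ω) θ ∧
      ∀ y ∈ face (polygon ω) θ, ∃ t : ℝ, 0 ≤ t ∧ y = ω.2 i + t • dir θ := by
  obtain ⟨i, hi⟩ := exists_lex_min ω hω (leftNormal θ) (dir θ)
  refine ⟨i, ⟨mem_polygon ω i, fun y hy => (hi y hy).1⟩, fun y hy => ?_⟩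
  have he := le_antisymm (hi y hy.1).1 (hy.2 _ (mem_polygon ω i))
  exact ⟨_, sub_nonneg.2 ((hi y hy.1).2 he.symm), eq_add_smul_dir_of_inner_eq he⟩

/-- The final point of the face at angle `θ` is one of the points of the configuration. -/
theorem exists_last_vertex (ω : Config) (hω : 0 < ω.1) (θ : ℝ) :
    ∃ j, ω.2 j ∈ face (polygon ω) θ ∧
      ∀ y ∈ face (polygon ω) θ, ∃ t : ℝ, 0 ≤ t ∧ ω.2 j = y + t • dir θ := by
  obtain ⟨j, hj⟩ := exists_lex_min ω hω (leftNormal θ) (-dir θ)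
  refine ⟨j, ⟨mem_polygon ω j, fun y hy => (hj y hy).1⟩, fun y hy => ?_⟩
  have he := le_antisymm (hy.2 _ (mem_polygon ω j)) (hj y hy.1).1
  have h2 := (hj y hy.1).2 he
  simp only [inner_neg_left, neg_le_neg_iff] at h2
  exact ⟨_, sub_nonneg.2 h2, eq_add_smul_dir_of_inner_eq he⟩

theorem dir_eq_iff {θ θ' : ℝ} : dir θ = dir θ' ↔ (θ : Real.Angle) = θ' := by
  constructor
  · intro h
    refine Real.Angle.cos_sin_inj ?_ ?_
    · simpa [dir] using congrArg (fun x : Plane => x 0) h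
    · simpa [dir] using congrArg (fun x : Plane => x 1) h
  · intro h
    have h1 := congrArg Real.Angle.cos h
    have h2 := congrArg Real.Angle.sin h
    simp only [Real.Angle.cos_coe, Real.Angle.sin_coe] at h1 h2
    simp [dir, h1, h2]

theorem dir_ne_zero (θ : ℝ) : dir θ ≠ 0 := by
  intro h
  have := norm_dir θ
  simp [h] at this

/-- A point of a polygon is the initial point of at most one edge. -/
theorem angle_eq_of_common_first_vertex {P : Set Plane} {θ θ' : ℝ} {w : Plane}
    (hw : w ∈ face P θ) (hfirst : ∀ y ∈ face P θ, ∃ t : ℝ, 0 ≤ t ∧ y = w + t • dir θ)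
    (hw' : w ∈ face P θ') (hfirst' : ∀ y ∈ face P θ', ∃ t : ℝ, 0 ≤ t ∧ y = w + t • dir θ')
    (hn : (face P θ).Nontrivial) (hn' : (face P θ').Nontrivial) :
    (θ : Real.Angle) = θ' := by
  obtain ⟨y, hy, hyw⟩ := hn.exists_ne w
  obtain ⟨t, ht, rfl⟩ := hfirst y hy
  obtain ⟨y', hy', hyw'⟩ := hn'.exists_ne w
  obtain ⟨t', ht', rfl⟩ := hfirst' y' hy'
  have ht0 : 0 < t := ht.lt_of_ne fun h => by simp [← h] at hyw
  have ht0' : 0 < t' := ht'.lt_of_ne fun h => by simp [← h] at hyw'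
  have h1 := hw.2 _ hy'.1
  have h2 := hw'.2 _ hy.1
  rw [inner_add_right, inner_smul_right, inner_leftNormal_dir, le_add_iff_nonneg_right] at h1 h2
  have h1 := nonneg_of_mul_nonneg_right h1 ht0'
  have h2 := nonneg_of_mul_nonneg_right h2 ht0
  rw [← neg_sub θ' θ, Real.sin_neg] at h2
  have hsin : Real.sin (θ' - θ) = 0 := le_antisymm (by linarith) h1
  have hdir := cos_smul_dir_add_sin_smul_leftNormal θ (θ' - θ)
  rw [hsin, zero_smul, add_zero, add_sub_cancel] at hdir
  rcases Real.sin_eq_zero_iff_cos_eq.1 hsin with hcos | hcos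
  · rw [hcos, one_smul] at hdir
    exact dir_eq_iff.1 hdir
  · exfalso
    rw [hcos, neg_one_smul] at hdir
    have hface : w + t' • dir θ' ∈ face P θ := by
      refine ⟨hy'.1, fun z hz => ?_⟩
      rw [inner_add_right, inner_smul_right, inner_leftNormal_dir, hsin, mul_zero, add_zero]
      exact hw.2 z hz
    obtain ⟨s, hs, he⟩ := hfirst _ hface
    rw [← hdir, add_right_inj, smul_neg, neg_eq_iff_add_eq_zero, ← add_smul, smul_eq_zero] at he
    rcases he with he | he
    · linarith
    · exact dir_ne_zero θ he

theorem pointCount_eq_ncard (D : Set Plane) (ω : Config) :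
    pointCount D ω = (Set.ncard {i | ω.2 i ∈ D} : ℝ) := by
  classical
  rw [pointCount, Set.ncard_eq_toFinset_card']
  simp [indicator_apply, Finset.sum_boole]

theorem edgeCount_le_pointCount (ω : Config) {α β : ℝ} {D : Set Plane}
    (hD : ∀ θ ∈ Icc α β, face (polygon ω) θ ⊆ D) :
    edgeCount (polygon ω) α β ≤ pointCount D ω := by
  classical
  rw [pointCount_eq_ncard, edgeCount, Nat.cast_le]
  rcases Nat.eq_zero_or_pos ω.1 with h0 | hω
  · have hP : polygon ω = ∅ := by
      rw [← not_nonempty_iff_eq_empty, polygon_nonempty_iff]; omega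
    have : {φ : Real.Angle | ∃ θ ∈ Icc α β, (θ : Real.Angle) = φ ∧
        (face (polygon ω) θ).Nontrivial} = ∅ := by
      ext φ
      simp [face, hP]
    rw [this, ncard_empty]
    exact Nat.zero_le _
  choose v hv hfirst using fun θ => exists_first_vertex ω hω θ
  have hch : ∀ φ : Real.Angle, ∃ θ : ℝ, (∃ θ ∈ Icc α β, (θ : Real.Angle) = φ ∧
      (face (polygon ω) θ).Nontrivial) → θ ∈ Icc α β ∧ (θ : Real.Angle) = φ ∧
      (face (polygon ω) θ).Nontrivial := by
    intro φ
    by_cases h : ∃ θ ∈ Icc α β, (θ : Real.Angle) = φ ∧ (face (polygon ω) θ).Nontrivial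
    · obtain ⟨θ, h1⟩ := h
      exact ⟨θ, fun _ => h1⟩
    · exact ⟨0, fun h' => absurd h' h⟩
  choose τ hτ using hch
  refine Set.ncard_le_ncard_of_injOn (fun φ => v (τ φ)) ?_ ?_ (Set.toFinite _)
  · intro φ hφ
    exact hD _ (hτ φ hφ).1 (hv _)
  · intro φ hφ φ' hφ' he
    simp only at he
    rw [← (hτ φ hφ).2.1, ← (hτ φ' hφ').2.1]
    refine angle_eq_of_common_first_vertex (hv _) (hfirst _) ?_ ?_ (hτ φ hφ).2.2 (hτ φ' hφ').2.2
    · rw [he]; exact hv _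
    · rw [he]; exact hfirst _

/-- If the polygon has a point `z` in the intersection of the two half-planes, then at the angles
between `α` and `β` it only touches tangent lines in their union. -/
theorem face_subset_capUnion {ω : Config} {α β : ℝ} (hβ : β < α + Real.pi) {q : Plane}
    (h : ∃ i, ω.2 i ∈ capInter α β q) {θ : ℝ} (hθ : θ ∈ Icc α β) {w : Plane}
    (hw : w ∈ face (polygon ω) θ) {t : ℝ} :
    w + t • dir θ ∈ capUnion α β q := by
  obtain ⟨i, h1, h2⟩ := h
  rw [mem_halfPlane_inner] at h1 h2
  have h3 := inner_leftNormal_nonpos_of_mem_Icc hθ hβ h1 h2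
  have h4 := hw.2 _ (mem_polygon ω i)
  by_contra hc
  simp only [capUnion, mem_union, mem_halfPlane_inner, not_or, not_le] at hc
  have h5 := inner_leftNormal_pos_of_mem_Icc hθ hβ hc.1 hc.2
  simp only [inner_sub_right, inner_add_right, inner_smul_right, inner_leftNormal_dir, sub_self,
    Real.sin_zero, mul_zero, add_zero] at h3 h5
  linarith

theorem sweptRegion_subset_capUnion {ω : Config} {α β : ℝ} (hβ : β < α + Real.pi)
    {q : Plane} (h : ∃ i, ω.2 i ∈ capInter α β q) :
    sweptRegion K (polygon ω) α β ⊆ K ∩ capUnion α β q := by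
  rintro x ⟨⟨hxK, -⟩, hx⟩
  obtain ⟨θ, hθ, w, hw, t, -, rfl⟩ := hx ⟨_, mem_polygon ω h.choose⟩
  exact ⟨hxK, face_subset_capUnion hβ h hθ hw⟩

theorem sweptRegion_subset (K P : Set Plane) (α β : ℝ) : sweptRegion K P α β ⊆ K :=
  fun _ hx => hx.1.1

/-! ### Exponential moments for short arcs -/

theorem measurableSet_capInter (α β : ℝ) (q : Plane) : MeasurableSet (capInter α β q) :=
  (measurableSet_halfPlane _ _).inter (measurableSet_halfPlane _ _)

theorem measurableSet_capUnion (α β : ℝ) (q : Plane) : MeasurableSet (capUnion α β q) :=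
  (measurableSet_halfPlane _ _).union (measurableSet_halfPlane _ _)

theorem pointCount_nonneg (D : Set Plane) (ω : Config) : 0 ≤ pointCount D ω :=
  Finset.sum_nonneg fun _ _ => indicator_nonneg (fun _ _ => zero_le_one) _

/-- A functional of the configuration has a bounded exponential moment if it is controlled, in
terms of the cap of area `k` at angle `α` with a point `q` on its chord, by the part of `K` in
`capUnion α β q` as soon as there is a point in `capInter α β q`. -/
theorem lintegral_exp_le_of_caps (hK : Convex ℝ K) (ho : IsOpen K) (hb : Bornology.IsBounded K)
    {α β : ℝ} (hαβ : α ≤ β) (hβ : β < α + Real.pi)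
    (hμ : affineMeasure K (Icc α β) ≤ ENNReal.ofReal (1 / 6)) {X : Config → ℝ}
    (hX : ∀ q : Plane, ∀ ω : Config, (∃ i, ω.2 i ∈ capInter α β q) →
      X ω ≤ area (K ∩ capUnion α β q) + pointCount (capUnion α β q) ω)
    (hX' : ∀ ω : Config, X ω ≤ area K + pointCount univ ω) :
    ∫⁻ ω, ENNReal.ofReal (Real.exp (localRate * X ω)) ∂poissonLaw K ≤
      ENNReal.ofReal momentBound := by
  -- For small `K` the chord comparison is not available, but the trivial bound suffices.
  rcases lt_or_ge (area K) 2 with hsmall | hlarge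
  · refine lintegral_exp_le_of_scales hb 0 (by norm_num; linarith) (O := fun _ => ∅)
      (D := fun _ => ∅) (fun _ => MeasurableSet.empty) (fun _ => MeasurableSet.empty)
      (fun k h1 h2 => by omega) (fun k h1 h2 => by omega) (fun k h1 h2 => by omega)
      fun ω => (hX' ω).trans ?_
    norm_num
    exact hsmall.le
  · -- `N` is the largest integer less than `area K`, so that the caps of area `k ≤ N` exist.
    set N := ⌈area K⌉₊ - 1 with hN
    have hceil : 1 ≤ ⌈area K⌉₊ := Nat.one_le_ceil_iff.2 (by linarith)
    have hNle : area K ≤ N + 1 := by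
      have := Nat.le_ceil (area K)
      rw [← Nat.sub_add_cancel hceil] at this
      exact_mod_cast this
    have hlt : ∀ k ≤ N, (k : ℝ) < area K := fun k hk => Nat.lt_ceil.1 (by omega)
    have hq : ∀ k : ℕ, ∃ q : Plane, 1 ≤ k → k ≤ N →
        q ∈ K ∧ area (K ∩ halfPlane α (inner ℝ (leftNormal α) q)) = k := by
      intro k
      by_cases h : 1 ≤ k ∧ k ≤ N
      · have h1 : (1 : ℝ) ≤ k := by exact_mod_cast h.1
        have ha := area_inter_halfPlane_capLevel ho.measurableSet hb α k.cast_nonneg (hlt k h.2)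
        obtain ⟨q, hqK, hqc⟩ := slice_nonempty_of_area hK (θ := α) (c := capLevel K k α)
          (by linarith) (by linarith [hlt k h.2])
        exact ⟨q, fun _ _ => ⟨hqK, by rw [hqc]; exact ha⟩⟩
      · exact ⟨0, fun h1 h2 => absurd ⟨h1, h2⟩ h⟩
    choose q hq using hq
    have key : ∀ k, 1 ≤ k → k ≤ N → (k : ℝ) / 2 ≤ area (K ∩ capInter α β (q k)) ∧
        area (K ∩ capUnion α β (q k)) ≤ 2 * k := fun k h1 h2 =>
      area_capInter_capUnion hK ho hb hlarge (hq k h1 h2).1 hαβ hβ hμ (by exact_mod_cast h1)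
        (hq k h1 h2).2
    refine lintegral_exp_le_of_scales hb N (by linarith) (O := fun k => capInter α β (q k))
      (D := fun k => capUnion α β (q k)) (fun k => measurableSet_capInter _ _ _)
      (fun k => measurableSet_capUnion _ _ _) (fun k h1 h2 => (key k h1 h2).1)
      (fun k h1 h2 => (key k h1 h2).2) (fun k h1 h2 ω hω => ?_) fun ω => ?_
    · linarith [hX (q k) ω hω, (key k h1 h2).2]
    · have : (0 : ℝ) ≤ N := N.cast_nonneg
      linarith [hX' ω]

theorem lintegral_exp_edgeCount_le (hK : Convex ℝ K) (ho : IsOpen K) (hb : Bornology.IsBounded K)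
    {α β : ℝ} (hαβ : α ≤ β) (hβ : β < α + Real.pi)
    (hμ : affineMeasure K (Icc α β) ≤ ENNReal.ofReal (1 / 6)) :
    ∫⁻ ω, ENNReal.ofReal (Real.exp (localRate * edgeCount (polygon ω) α β)) ∂poissonLaw K ≤
      ENNReal.ofReal momentBound := by
  refine lintegral_exp_le_of_caps hK ho hb hαβ hβ hμ (fun q ω hω => ?_) fun ω => ?_
  · have := edgeCount_le_pointCount ω (α := α) (β := β) (D := capUnion α β q) fun θ hθ w hw => by
      simpa using face_subset_capUnion hβ hω hθ hw (t := 0)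
    linarith [area_nonneg (K ∩ capUnion α β q)]
  · linarith [edgeCount_le_pointCount ω (α := α) (β := β) (D := univ) fun _ _ => subset_univ _,
      area_nonneg K]

theorem lintegral_exp_missedArea_le (hK : Convex ℝ K) (ho : IsOpen K) (hb : Bornology.IsBounded K)
    {α β : ℝ} (hαβ : α ≤ β) (hβ : β < α + Real.pi)
    (hμ : affineMeasure K (Icc α β) ≤ ENNReal.ofReal (1 / 6)) :
    ∫⁻ ω, ENNReal.ofReal (Real.exp (localRate * missedArea K (polygon ω) α β)) ∂poissonLaw K ≤
      ENNReal.ofReal momentBound := by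
  refine lintegral_exp_le_of_caps hK ho hb hαβ hβ hμ (fun q ω hω => ?_) fun ω => ?_
  · have := area_mono (hb.subset inter_subset_left)
      (sweptRegion_subset_capUnion (K := K) hβ hω)
    rw [missedArea]
    linarith [pointCount_nonneg (capUnion α β q) ω]
  · have := area_mono hb (sweptRegion_subset K (polygon ω) α β)
    rw [missedArea]
    linarith [pointCount_nonneg univ ω]

/-! ### Measurability of the functionals -/

/-- The angle in `(-π, π]` of a vector of the plane, with the junk value `0` for the zero
vector. -/
noncomputable def vecAngle (v : Plane) : ℝ := Complex.arg ⟨v 0, v 1⟩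

theorem norm_smul_dir_vecAngle (v : Plane) : ‖v‖ • dir (vecAngle v) = v := by
  have hn : ‖(⟨v 0, v 1⟩ : ℂ)‖ = ‖v‖ := by
    rw [EuclideanSpace.norm_eq, Complex.norm_def, Complex.normSq_mk, Fin.sum_univ_two]
    simp [sq]
  have h1 := Complex.norm_mul_cos_arg (⟨v 0, v 1⟩ : ℂ)
  have h2 := Complex.norm_mul_sin_arg (⟨v 0, v 1⟩ : ℂ)
  rw [hn] at h1 h2
  ext i
  fin_cases i
  · simpa [dir, vecAngle] using h1
  · simpa [dir, vecAngle] using h2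

theorem coe_vecAngle_smul_dir {t : ℝ} (ht : 0 < t) (θ : ℝ) :
    (vecAngle (t • dir θ) : Real.Angle) = θ := by
  have h := norm_smul_dir_vecAngle (t • dir θ)
  rw [norm_smul, norm_dir, mul_one, Real.norm_of_nonneg ht.le] at h
  exact dir_eq_iff.1 (smul_right_injective Plane ht.ne' h)

theorem measurable_vecAngle : Measurable vecAngle := by
  have h : Measurable fun v : Plane => ((v 0 : ℂ) + (v 1 : ℂ) * Complex.I) := by fun_prop
  have e : vecAngle = fun v : Plane => Complex.arg ((v 0 : ℂ) + (v 1 : ℂ) * Complex.I) := by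
    funext v
    rw [vecAngle, Complex.mk_eq_add_mul_I]
  rw [e]
  exact Complex.measurable_arg.comp h

theorem leftNormal_congr {θ θ' : ℝ} (h : (θ : Real.Angle) = θ') : leftNormal θ = leftNormal θ' := by
  have h1 := congrArg Real.Angle.cos h
  have h2 := congrArg Real.Angle.sin h
  simp only [Real.Angle.cos_coe, Real.Angle.sin_coe] at h1 h2
  simp [leftNormal, h1, h2]

/-- The real numbers that represent an element of the arc `[α, β]` of `ℝ/2π`. -/
def arcLift (α β : ℝ) : Set ℝ := {a | ∃ θ ∈ Icc α β, (θ : Real.Angle) = a}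

theorem measurableSet_arcLift (α β : ℝ) : MeasurableSet (arcLift α β) := by
  have : arcLift α β = ⋃ k : ℤ, (fun a => a + 2 * Real.pi * k) ⁻¹' Icc α β := by
    ext a
    simp only [arcLift, mem_ofPred_eq, mem_iUnion, mem_preimage,
      Real.Angle.angle_eq_iff_two_pi_dvd_sub]
    constructor
    · rintro ⟨θ, hθ, k, hk⟩
      exact ⟨k, by rwa [← hk, add_sub_cancel]⟩
    · rintro ⟨k, hk⟩
      exact ⟨_, hk, k, by ring⟩
  rw [this]
  exact MeasurableSet.iUnion fun k => (measurable_id.add_const _) measurableSet_Icc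

/-- The line through `ω i` and `x`, oriented from `ω i` to `x`, is a tangent line of the polygon,
and its angle lies in the arc `[α, β]`. -/
def IsTangentFrom {n : ℕ} (α β : ℝ) (ω : Fin n → Plane) (i : Fin n) (x : Plane) : Prop :=
  x ≠ ω i ∧ vecAngle (x - ω i) ∈ arcLift α β ∧
    ∀ k, 0 ≤ inner ℝ (leftNormal (vecAngle (x - ω i))) (ω k - ω i)

theorem measurableSet_isTangentFrom {n : ℕ} (α β : ℝ) (i : Fin n) :
    MeasurableSet {p : (Fin n → Plane) × Plane | IsTangentFrom α β p.1 i p.2} := by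
  have h1 : Measurable fun p : (Fin n → Plane) × Plane => vecAngle (p.2 - p.1 i) :=
    measurable_vecAngle.comp (by fun_prop)
  have h2 : Continuous leftNormal := by unfold leftNormal; fun_prop
  have h3 : ∀ k, Measurable fun p : (Fin n → Plane) × Plane =>
      (inner ℝ (leftNormal (vecAngle (p.2 - p.1 i))) (p.1 k - p.1 i) : ℝ) := fun k =>
    (h2.measurable.comp h1).inner (by fun_prop)
  have h4 : {p : (Fin n → Plane) × Plane | IsTangentFrom α β p.1 i p.2} =
      {p | p.2 = p.1 i}ᶜ ∩ ((fun p => vecAngle (p.2 - p.1 i)) ⁻¹' arcLift α β ∩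
        ⋂ k, {p | 0 ≤ (inner ℝ (leftNormal (vecAngle (p.2 - p.1 i))) (p.1 k - p.1 i) : ℝ)}) := by
    ext p
    simp [IsTangentFrom]
  rw [h4]
  exact (measurableSet_eq_fun (by fun_prop) (by fun_prop)).compl.inter
    ((h1 (measurableSet_arcLift α β)).inter
      (MeasurableSet.iInter fun k => measurableSet_le measurable_const (h3 k)))

theorem mem_face_of_vecAngle {ω : Config} {i : Fin ω.1} {x : Plane} {θ : ℝ}
    (hθ : (θ : Real.Angle) = vecAngle (x - ω.2 i))
    (h : ∀ k, 0 ≤ inner ℝ (leftNormal (vecAngle (x - ω.2 i))) (ω.2 k - ω.2 i)) :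
    ω.2 i ∈ face (polygon ω) θ ∧ x = ω.2 i + ‖x - ω.2 i‖ • dir θ := by
  refine ⟨mem_face_iff.2 ⟨mem_polygon ω i, fun k => ?_⟩, ?_⟩
  · have := h k
    rw [← leftNormal_congr hθ, inner_sub_right] at this
    linarith
  · rw [dir_eq_iff.2 hθ, norm_smul_dir_vecAngle]
    abel

theorem isTangentFrom_of_mem_face {ω : Config} {i : Fin ω.1} {θ α β t : ℝ} (hθ : θ ∈ Icc α β)
    (hi : ω.2 i ∈ face (polygon ω) θ) (ht : 0 < t) :
    IsTangentFrom α β ω.2 i (ω.2 i + t • dir θ) := by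
  have hang : (vecAngle (ω.2 i + t • dir θ - ω.2 i) : Real.Angle) = θ := by
    rw [add_sub_cancel_left]
    exact coe_vecAngle_smul_dir ht θ
  refine ⟨fun h => ?_, ⟨θ, hθ, hang.symm⟩, fun k => ?_⟩
  · rw [add_eq_left, smul_eq_zero] at h
    exact h.elim ht.ne' (dir_ne_zero θ)
  · rw [leftNormal_congr hang, inner_sub_right, sub_nonneg]
    exact hi.2 _ (mem_polygon ω k)

/-- The edge angles are the angles of the vectors between two points of the configuration that
span a tangent line. -/
theorem edgeAngles_eq_image (ω : Config) (α β : ℝ) :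
    {φ : Real.Angle | ∃ θ ∈ Icc α β, (θ : Real.Angle) = φ ∧ (face (polygon ω) θ).Nontrivial} =
      (fun a : ℝ => (a : Real.Angle)) '' {a : ℝ | ∃ p : Fin ω.1 × Fin ω.1,
        IsTangentFrom α β ω.2 p.1 (ω.2 p.2) ∧ vecAngle (ω.2 p.2 - ω.2 p.1) = a} := by
  ext φ
  constructor
  · rintro ⟨θ, hθ, rfl, hn⟩
    have hω : 0 < ω.1 := (polygon_nonempty_iff ω).1 (hn.nonempty.mono fun _ h => h.1)
    obtain ⟨i, hi, hfirst⟩ := exists_first_vertex ω hω θ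
    obtain ⟨j, hj, hlast⟩ := exists_last_vertex ω hω θ
    obtain ⟨t, ht, he⟩ := hfirst _ hj
    have ht0 : 0 < t := by
      refine ht.lt_of_ne fun h0 => ?_
      rw [← h0, zero_smul, add_zero] at he
      obtain ⟨y, hy, hne⟩ := hn.exists_ne (ω.2 i)
      obtain ⟨s, hs, hys⟩ := hfirst y hy
      obtain ⟨s', hs', hys'⟩ := hlast y hy
      rw [he, hys, add_assoc, left_eq_add, ← add_smul, smul_eq_zero] at hys'
      rcases hys' with h | h
      · have : s = 0 := by linarith
        rw [this, zero_smul, add_zero] at hys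
        exact hne hys
      · exact dir_ne_zero θ h
    refine ⟨vecAngle (ω.2 j - ω.2 i), ⟨(i, j), ?_, rfl⟩, ?_⟩
    · rw [he]
      exact isTangentFrom_of_mem_face hθ hi ht0
    · rw [he, add_sub_cancel_left]
      exact coe_vecAngle_smul_dir ht0 θ
  · rintro ⟨_, ⟨⟨i, j⟩, ⟨hne, ⟨θ, hθ, hang⟩, hleft⟩, rfl⟩, rfl⟩
    obtain ⟨hi, hj⟩ := mem_face_of_vecAngle hang hleft
    refine ⟨θ, hθ, hang, ω.2 j, ⟨mem_polygon ω j, fun y hy => ?_⟩, ω.2 i, hi, hne⟩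
    rw [hj, inner_add_right, inner_smul_right, inner_leftNormal_dir, sub_self, Real.sin_zero,
      mul_zero, add_zero]
    exact hi.2 y hy

theorem finite_edgeAngles (ω : Config) (α β : ℝ) :
    {φ : Real.Angle | ∃ θ ∈ Icc α β, (θ : Real.Angle) = φ ∧
      (face (polygon ω) θ).Nontrivial}.Finite := by
  rw [edgeAngles_eq_image]
  refine Set.Finite.image _ ((Set.finite_range fun p : Fin ω.1 × Fin ω.1 =>
    vecAngle (ω.2 p.2 - ω.2 p.1)).subset ?_)
  rintro _ ⟨p, -, rfl⟩
  exact mem_range_self p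

theorem edgeCount_eq_ncard (ω : Config) (α β : ℝ) :
    edgeCount (polygon ω) α β = (Set.ncard {a : ℝ | ∃ p : Fin ω.1 × Fin ω.1,
      IsTangentFrom α β ω.2 p.1 (ω.2 p.2) ∧ vecAngle (ω.2 p.2 - ω.2 p.1) = a} : ℝ) := by
  rw [edgeCount, edgeAngles_eq_image, InjOn.ncard_image]
  rintro _ ⟨p, -, rfl⟩ _ ⟨p', -, rfl⟩ h
  exact Complex.arg_coe_angle_eq_iff.1 h

theorem measurable_ncard_values {Ω ι : Type*} [MeasurableSpace Ω] [Fintype ι] {T : ι → Set Ω}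
    {v : ι → Ω → ℝ} (hT : ∀ p, MeasurableSet (T p)) (hv : ∀ p, Measurable (v p)) :
    Measurable fun ω => (Set.ncard {a : ℝ | ∃ p, ω ∈ T p ∧ v p ω = a} : ℝ) := by
  classical
  have key : ∀ s : Finset ι,
      Measurable fun ω => (Set.ncard {a : ℝ | ∃ p ∈ s, ω ∈ T p ∧ v p ω = a} : ℝ) := by
    intro s
    induction s using Finset.induction_on with
    | empty => simp
    | insert p s hp ih =>
      -- The value `v p ω` is new if it is not among the values with indices in `s`.
      set C : Set Ω := T p ∩ ⋂ p' ∈ s, (T p' ∩ {ω | v p' ω = v p ω})ᶜ with hC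
      have hCm : MeasurableSet C := (hT p).inter (Finset.measurableSet_biInter s fun p' _ =>
        ((hT p').inter (measurableSet_eq_fun (hv p') (hv p))).compl)
      have heq : (fun ω => (Set.ncard {a : ℝ | ∃ p' ∈ insert p s, ω ∈ T p' ∧ v p' ω = a} : ℝ)) =
          fun ω => (Set.ncard {a : ℝ | ∃ p' ∈ s, ω ∈ T p' ∧ v p' ω = a} : ℝ) +
            C.indicator (fun _ => 1) ω := by
        funext ω
        set S := {a : ℝ | ∃ p' ∈ s, ω ∈ T p' ∧ v p' ω = a} with hS
        have hfin : S.Finite := (s.finite_toSet.image fun p' => v p' ω).subset (by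
          rintro _ ⟨p', h1, -, rfl⟩
          exact ⟨p', h1, rfl⟩)
        by_cases h : ω ∈ C
        · have hnew : v p ω ∉ S := by
            rintro ⟨p', h1, h2, h3⟩
            have h4 := h.2
            simp only [mem_iInter] at h4
            exact h4 p' h1 ⟨h2, h3⟩
          have : {a : ℝ | ∃ p' ∈ insert p s, ω ∈ T p' ∧ v p' ω = a} = insert (v p ω) S := by
            ext a
            simp only [Finset.mem_insert, mem_ofPred_eq, mem_insert_iff, hS,
              exists_eq_or_imp]
            exact or_congr_left ⟨fun h1 => h1.2.symm, fun h1 => ⟨h.1, h1.symm⟩⟩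
          rw [this, ncard_insert_of_notMem hnew hfin, indicator_of_mem h]
          push_cast
          rfl
        · have : {a : ℝ | ∃ p' ∈ insert p s, ω ∈ T p' ∧ v p' ω = a} = S := by
            ext a
            simp only [Finset.mem_insert, mem_ofPred_eq, hS, exists_eq_or_imp]
            refine or_iff_right_of_imp ?_
            rintro ⟨h1, rfl⟩
            by_contra hc
            refine h ⟨h1, ?_⟩
            simp only [mem_iInter]
            exact fun p' hp' h2 => hc ⟨p', hp', h2.1, h2.2⟩
          rw [this, indicator_of_notMem h, add_zero]
      rw [heq]
      exact ih.add (measurable_const.indicator hCm)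
  simpa using key Finset.univ

theorem measurable_edgeCount (α β : ℝ) :
    Measurable fun ω : Config => edgeCount (polygon ω) α β := by
  refine measurable_config fun n => ?_
  simp only [edgeCount_eq_ncard]
  refine measurable_ncard_values (ι := Fin n × Fin n)
    (T := fun p => {ω : Fin n → Plane | IsTangentFrom α β ω p.1 (ω p.2)})
    (v := fun p ω => vecAngle (ω p.2 - ω p.1)) (fun p => ?_) fun p => ?_
  · exact (by fun_prop : Measurable fun ω : Fin n → Plane => (ω, ω p.2))
      (measurableSet_isTangentFrom α β p.1)
  · exact measurable_vecAngle.comp (by fun_prop)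

theorem volume_sweptRegion (ω : Config) (hω : 0 < ω.1) (α β : ℝ) :
    volume (sweptRegion K (polygon ω) α β) =
      volume {x ∈ K | ∃ i, IsTangentFrom α β ω.2 i x} := by
  refine le_antisymm (measure_mono ?_) ?_
  · rintro x ⟨⟨hxK, hxP⟩, hx⟩
    obtain ⟨θ, hθ, w, hw, t, ht, rfl⟩ := hx ((polygon_nonempty_iff ω).2 hω)
    obtain ⟨i, hi, hfirst⟩ := exists_first_vertex ω hω θ
    obtain ⟨s, hs, rfl⟩ := hfirst w hw
    rw [add_assoc, ← add_smul] at hxK hxP ⊢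
    refine ⟨hxK, i, isTangentFrom_of_mem_face hθ hi ?_⟩
    refine (add_nonneg hs ht).lt_of_ne fun h => hxP ?_
    rw [← h, zero_smul, add_zero]
    exact mem_polygon ω i
  · -- A point of the polygon on a tangent line is a boundary point.
    have hsub : {x ∈ K | ∃ i, IsTangentFrom α β ω.2 i x} ⊆
        sweptRegion K (polygon ω) α β ∪ frontier (polygon ω) := by
      rintro x ⟨hxK, i, -, ⟨θ, hθ, hang⟩, hleft⟩
      obtain ⟨hi, hx⟩ := mem_face_of_vecAngle hang hleft
      by_cases hxP : x ∈ polygon ω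
      · refine Or.inr ⟨subset_closure hxP, fun hint => ?_⟩
        have hcont : ContinuousAt (fun s : ℝ => x - s • leftNormal θ) 0 := by fun_prop
        have hmem : polygon ω ∈ nhds (x - (0 : ℝ) • leftNormal θ) := by
          simpa using mem_interior_iff_mem_nhds.1 hint
        have hev := (hcont.eventually_mem hmem).filter_mono
          (nhdsWithin_le_nhds (s := Ioi 0))
        obtain ⟨s, hs, hs0⟩ := (hev.and self_mem_nhdsWithin).exists
        have h1 := hi.2 _ hs
        have hs0 : 0 < s := hs0
        rw [hx, inner_sub_right, inner_add_right, inner_smul_right, inner_smul_right,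
          inner_leftNormal_dir, inner_leftNormal_leftNormal, sub_self, Real.sin_zero] at h1
        linarith
      · exact Or.inl ⟨⟨hxK, hxP⟩, fun _ => ⟨θ, hθ, _, hi, _, norm_nonneg _, hx⟩⟩
    refine (measure_mono hsub).trans ((measure_union_le _ _).trans (le_of_eq ?_))
    rw [polygon, (convex_convexHull ℝ _).addHaar_frontier volume, add_zero]

theorem measurable_missedArea (hm : MeasurableSet K) (α β : ℝ) :
    Measurable fun ω : Config => missedArea K (polygon ω) α β := by
  refine measurable_config fun n => ?_
  rcases Nat.eq_zero_or_pos n with rfl | hn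
  · exact Subsingleton.measurable
  have heq : ∀ x : Fin n → Plane, missedArea K (polygon ⟨n, x⟩) α β =
      (volume {y ∈ K | ∃ i, IsTangentFrom α β x i y}).toReal := fun x => by
    rw [missedArea, area, volume_sweptRegion ⟨n, x⟩ hn]
  simp only [heq]
  refine Measurable.ennreal_toReal ?_
  have hG : MeasurableSet {p : (Fin n → Plane) × Plane |
      p.2 ∈ K ∧ ∃ i, IsTangentFrom α β p.1 i p.2} := by
    have : {p : (Fin n → Plane) × Plane | p.2 ∈ K ∧ ∃ i, IsTangentFrom α β p.1 i p.2} =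
        Prod.snd ⁻¹' K ∩ ⋃ i, {p | IsTangentFrom α β p.1 i p.2} := by
      ext p; simp
    rw [this]
    exact (measurable_snd hm).inter
      (MeasurableSet.iUnion fun i => measurableSet_isTangentFrom α β i)
  exact measurable_measure_prodMk_left hG

/-! ### Reduction to open convex sets -/

theorem interior_ae_eq (hK : Convex ℝ K) : interior K =ᵐ[volume] K :=
  interior_ae_eq_of_null_frontier (hK.addHaar_frontier volume)

theorem area_interior_inter (hK : Convex ℝ K) (S : Set Plane) :
    area (interior K ∩ S) = area (K ∩ S) := by
  rw [area, area, measure_congr ((interior_ae_eq hK).inter (ae_eq_refl S))]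

theorem area_interior (hK : Convex ℝ K) : area (interior K) = area K := by
  simpa using area_interior_inter hK univ

theorem poissonLaw_interior (hK : Convex ℝ K) : poissonLaw (interior K) = poissonLaw K := by
  rw [poissonLaw, poissonLaw, area_interior hK, Measure.restrict_congr_set (interior_ae_eq hK)]

theorem missedArea_interior (hK : Convex ℝ K) (P : Set Plane) (α β : ℝ) :
    missedArea (interior K) P α β = missedArea K P α β := by
  rw [missedArea, missedArea, area, area]
  congr 1
  refine le_antisymm (measure_mono fun x hx => ⟨⟨interior_subset hx.1.1, hx.1.2⟩, hx.2⟩) ?_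
  have hsub : sweptRegion K P α β ⊆ sweptRegion (interior K) P α β ∪ frontier K := by
    rintro x ⟨⟨hxK, hxP⟩, hx⟩
    by_cases h : x ∈ interior K
    · exact Or.inl ⟨⟨h, hxP⟩, hx⟩
    · exact Or.inr ⟨subset_closure hxK, h⟩
  refine (measure_mono hsub).trans ((measure_union_le _ _).trans (le_of_eq ?_))
  rw [hK.addHaar_frontier volume, add_zero]

theorem capChord_nonneg (x θ : ℝ) : 0 ≤ capChord K x θ := by
  rw [capChord]
  split_ifs
  exacts [chordLength_nonneg _ _, le_rfl]

theorem capChord_interior_le (hK : Convex ℝ K) (hb : Bornology.IsBounded K) (x θ : ℝ) :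
    capChord (interior K) x θ ≤ capChord K x θ := by
  rw [capChord, capChord, area_interior hK]
  split_ifs
  · have : capLevel (interior K) (Real.log (1 / x)) θ = capLevel K (Real.log (1 / x)) θ := by
      simp only [capLevel, area_interior_inter hK]
    rw [this]
    exact ENNReal.toReal_mono (volume_slice_ne_top hb _ _)
      (measure_mono fun t (ht : _ ∈ interior K) => show _ ∈ K from interior_subset ht)
  · exact le_rfl

theorem affineMeasure_interior_le (hK : Convex ℝ K) (hb : Bornology.IsBounded K) {S : Set ℝ}
    (hS : MeasurableSet S) : affineMeasure (interior K) S ≤ affineMeasure K S := by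
  rw [affineMeasure, affineMeasure, withDensity_apply _ hS, withDensity_apply _ hS]
  exact lintegral_mono fun θ => ENNReal.ofReal_le_ofReal
    (pow_le_pow_left₀ (capChord_nonneg _ _) (capChord_interior_le hK hb _ _) 2)

/-! ### Subdivision of an arc into pieces of small measure -/

instance nullSingletonClass_affineMeasure : NullSingletonClass (affineMeasure K) := by
  unfold affineMeasure
  infer_instance

theorem exists_affineMeasure_Ioc_le (hb : Bornology.IsBounded K) :
    ∃ B : ℝ, 0 ≤ B ∧ ∀ a b : ℝ, a ≤ b →
      affineMeasure K (Ioc a b) ≤ ENNReal.ofReal (B * (b - a)) := by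
  obtain ⟨R, hR0, hR⟩ := hb.subset_closedBall_lt 0 0
  refine ⟨(2 * R) ^ 2, by positivity, fun a b hab => ?_⟩
  have hle : ∀ θ, capChord K (Real.exp (-1)) θ ≤ 2 * R := fun θ => by
    rw [capChord]
    split_ifs
    exacts [chordLength_le hR hR0.le _ _, by positivity]
  rw [affineMeasure, withDensity_apply _ measurableSet_Ioc]
  calc _ ≤ ∫⁻ _ in Ioc a b, ENNReal.ofReal ((2 * R) ^ 2) := lintegral_mono fun θ =>
        ENNReal.ofReal_le_ofReal (pow_le_pow_left₀ (capChord_nonneg _ _) (hle θ) 2)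
    _ = _ := by
        rw [setLIntegral_const, Real.volume_Ioc, ← ENNReal.ofReal_mul (by positivity)]

/-- An arc can be cut into `m` pieces of measure and length at most `1 / 6`, where `m / 6` is the
sum of its measure and its length: cut at equal increments of this sum. -/
theorem exists_subdivision (hb : Bornology.IsBounded K) {α β : ℝ} (hαβ : α ≤ β) {m : ℕ}
    (hm0 : 0 < m)
    (hm : (affineMeasure K (Icc α β)).toReal + (β - α) ≤ m / 6) :
    ∃ t : ℕ → ℝ, (∀ i < m, t i ≤ t (i + 1) ∧ t (i + 1) ≤ t i + 1 / 6 ∧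
      affineMeasure K (Icc (t i) (t (i + 1))) ≤ ENNReal.ofReal (1 / 6)) ∧
      ∀ θ ∈ Icc α β, ∃ i < m, θ ∈ Icc (t i) (t (i + 1)) := by
  obtain ⟨B, hB0, hB⟩ := exists_affineMeasure_Ioc_le hb
  set ν := affineMeasure K with hν
  have hfin : ∀ a b : ℝ, ν (Ioc a b) ≠ ∞ := fun a b => by
    rcases le_total a b with h | h
    · exact ((hB a b h).trans_lt ENNReal.ofReal_lt_top).ne
    · simp [Ioc_eq_empty_of_le h]
  have hIcc : ∀ a b : ℝ, ν (Icc a b) = ν (Ioc a b) := fun a b =>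
    (measure_congr Ioc_ae_eq_Icc).symm
  -- The length is included to make `F` strictly increasing and to keep the pieces short.
  set F : ℝ → ℝ := fun θ => (ν (Ioc α θ)).toReal + (θ - α) with hF
  have hdiff : ∀ a b, α ≤ a → a ≤ b → F b - F a = (ν (Ioc a b)).toReal + (b - a) := by
    intro a b ha hab
    have hd : Disjoint (Ioc α a) (Ioc a b) := Ioc_disjoint_Ioc_of_le le_rfl
    simp only [hF]
    rw [← Ioc_union_Ioc_eq_Ioc ha hab, measure_union hd measurableSet_Ioc,
      ENNReal.toReal_add (hfin _ _) (hfin _ _)]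
    ring
  have hgrow : ∀ a b, α ≤ a → a ≤ b → b - a ≤ F b - F a := fun a b ha hab => by
    rw [hdiff a b ha hab]
    linarith [ENNReal.toReal_nonneg (a := ν (Ioc a b))]
  have hle : ∀ a b, α ≤ a → α ≤ b → F a ≤ F b → a ≤ b := by
    intro a b ha hb' h
    by_contra! hlt
    linarith [hgrow b a hb' hlt.le]
  have hlip : ∀ a b, α ≤ a → a ≤ b → F b - F a ≤ (B + 1) * (b - a) := fun a b ha hab => by
    rw [hdiff a b ha hab]
    have := ENNReal.toReal_le_of_le_ofReal (mul_nonneg hB0 (sub_nonneg.2 hab)) (hB a b hab)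
    linarith
  have hcont : ContinuousOn F (Icc α β) := by
    refine (LipschitzOnWith.of_dist_le_mul (K := ⟨B + 1, by positivity⟩) ?_).continuousOn
    intro a ha b hb'
    rw [Real.dist_eq, Real.dist_eq]
    change |F a - F b| ≤ (B + 1) * |a - b|
    rcases le_total a b with h | h
    · rw [abs_sub_comm, abs_sub_comm a b, abs_of_nonneg (sub_nonneg.2 h), abs_of_nonneg]
      · exact hlip a b ha.1 h
      · linarith [hgrow a b ha.1 h]
    · rw [abs_of_nonneg (sub_nonneg.2 h), abs_of_nonneg]
      · exact hlip b a hb'.1 h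
      · linarith [hgrow b a hb'.1 h]
  have hFα : F α = 0 := by simp [hF]
  have hFβ : F β ≤ m / 6 := by simpa only [hF, ← hIcc] using hm
  have hFβ0 : 0 ≤ F β := by linarith [hgrow α β le_rfl hαβ]
  have hmR : (0 : ℝ) < m := by exact_mod_cast hm0
  have hex : ∀ i : ℕ, ∃ t, i ≤ m → t ∈ Icc α β ∧ F t = F β * (i / m) := by
    intro i
    by_cases hi : i ≤ m
    · have hi' : (i : ℝ) / m ≤ 1 := (div_le_one hmR).2 (by exact_mod_cast hi)
      have hi0 : (0 : ℝ) ≤ i / m := by positivity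
      obtain ⟨t, ht, hFt⟩ := intermediate_value_Icc hαβ hcont
        (show F β * (i / m) ∈ Icc (F α) (F β) from
          ⟨by rw [hFα]; positivity, by nlinarith⟩)
      exact ⟨t, fun _ => ⟨ht, hFt⟩⟩
    · exact ⟨0, fun h => absurd h hi⟩
  choose t ht using hex
  refine ⟨t, fun i hi => ?_, fun θ hθ => ?_⟩
  · obtain ⟨h1, h1'⟩ := ht i hi.le
    obtain ⟨h2, h2'⟩ := ht (i + 1) hi
    have hstep : F (t (i + 1)) - F (t i) = F β / m := by
      rw [h1', h2']
      push_cast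
      field_simp
      ring
    have hstep6 : F β / m ≤ 1 / 6 := by
      rw [div_le_iff₀ hmR]
      linarith
    have hmono : t i ≤ t (i + 1) := hle _ _ h1.1 h2.1 (by
      have : 0 ≤ F β / m := by positivity
      linarith)
    have hd := hdiff _ _ h1.1 hmono
    have hnn : 0 ≤ (ν (Ioc (t i) (t (i + 1)))).toReal := ENNReal.toReal_nonneg
    refine ⟨hmono, by linarith, ?_⟩
    rw [hIcc]
    exact (ENNReal.le_ofReal_iff_toReal_le (hfin _ _) (by norm_num)).2 (by linarith)
  · have h0 : t 0 ≤ θ := by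
      obtain ⟨h1, h1'⟩ := ht 0 (Nat.zero_le m)
      refine hle _ _ h1.1 hθ.1 ?_
      rw [h1']
      have := hgrow α θ le_rfl hθ.1
      simp only [Nat.cast_zero, zero_div, mul_zero]
      linarith [hθ.1]
    have hlast : θ ≤ t m := by
      obtain ⟨h1, h1'⟩ := ht m le_rfl
      refine hle _ _ hθ.1 h1.1 ?_
      rw [h1', div_self hmR.ne', mul_one]
      linarith [hgrow θ β hθ.1 hθ.2, hθ.2]
    set k := Nat.findGreatest (fun i => t i ≤ θ) (m - 1) with hk
    have hkle : k ≤ m - 1 := Nat.findGreatest_le _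
    have hkθ : t k ≤ θ := Nat.findGreatest_spec (P := fun i => t i ≤ θ) (Nat.zero_le (m - 1)) h0
    refine ⟨k, by omega, hkθ, ?_⟩
    rcases hkle.eq_or_lt with h | h
    · have : k + 1 = m := by omega
      rwa [this]
    · exact (not_le.1 (Nat.findGreatest_is_greatest (P := fun i => t i ≤ θ)
        (Nat.lt_succ_self k) h)).le

theorem edgeCount_nonneg (P : Set Plane) (α β : ℝ) : 0 ≤ edgeCount P α β := Nat.cast_nonneg _

theorem edgeCount_le_sum (ω : Config) {α β : ℝ} {m : ℕ} {t : ℕ → ℝ}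
    (hcov : ∀ θ ∈ Icc α β, ∃ i < m, θ ∈ Icc (t i) (t (i + 1))) :
    edgeCount (polygon ω) α β ≤
      ∑ i ∈ Finset.range m, edgeCount (polygon ω) (t i) (t (i + 1)) := by
  simp only [edgeCount]
  rw [← Nat.cast_sum, Nat.cast_le]
  refine le_trans (Set.ncard_le_ncard ?_ ?_) (Finset.set_ncard_biUnion_le (Finset.range m) _)
  · rintro φ ⟨θ, hθ, h⟩
    obtain ⟨i, hi, hθi⟩ := hcov θ hθ
    exact mem_biUnion (Finset.mem_range.2 hi) ⟨θ, hθi, h⟩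
  · exact (Finset.range m).finite_toSet.biUnion fun i _ => finite_edgeAngles ω _ _

theorem missedArea_le_sum (hb : Bornology.IsBounded K) (P : Set Plane) {α β : ℝ} {m : ℕ}
    (hm0 : 0 < m) {t : ℕ → ℝ} (hcov : ∀ θ ∈ Icc α β, ∃ i < m, θ ∈ Icc (t i) (t (i + 1))) :
    missedArea K P α β ≤ ∑ i ∈ Finset.range m, missedArea K P (t i) (t (i + 1)) := by
  have hfin : ∀ a b, volume (sweptRegion K P a b) ≠ ∞ := fun a b =>
    volume_ne_top (hb.subset (sweptRegion_subset K P a b))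
  simp only [missedArea, area]
  rw [← ENNReal.toReal_sum fun i _ => hfin _ _]
  refine ENNReal.toReal_mono (ENNReal.sum_ne_top.2 fun i _ => hfin _ _)
    ((measure_mono ?_).trans (measure_biUnion_finset_le (Finset.range m) _))
  rintro x ⟨hxK, hx⟩
  rcases P.eq_empty_or_nonempty with hP | hP
  · exact mem_biUnion (Finset.mem_range.2 hm0) ⟨hxK, fun h => absurd hP h.ne_empty⟩
  · obtain ⟨θ, hθ, h⟩ := hx hP
    obtain ⟨i, hi, hθi⟩ := hcov θ hθ
    exact mem_biUnion (Finset.mem_range.2 hi) ⟨hxK, fun _ => ⟨θ, hθi, h⟩⟩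

/-! ### Averaging over the pieces -/

/-- If a nonnegative random variable is bounded by a sum of `m` random variables with bounded
exponential moments at rate `ρ`, then it has a bounded exponential moment at rate `ρ / m`, by
convexity of the exponential function. -/
theorem integrable_exp_of_le_sum {Ω : Type*} [MeasurableSpace Ω] {P : Measure Ω} {X : Ω → ℝ}
    (hX : Measurable X) (hX0 : ∀ ω, 0 ≤ X ω) {m : ℕ} (hm0 : 0 < m) {Y : ℕ → Ω → ℝ}
    (hY : ∀ i, Measurable (Y i)) (hXY : ∀ ω, X ω ≤ ∑ i ∈ Finset.range m, Y i ω)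
    {ρ C lam : ℝ} (hC : 0 ≤ C) (hlam : |lam| * m ≤ ρ)
    (hYexp : ∀ i < m, ∫⁻ ω, ENNReal.ofReal (Real.exp (ρ * Y i ω)) ∂P ≤ ENNReal.ofReal C) :
    Integrable (fun ω => Real.exp (lam * X ω)) P ∧ ∫ ω, Real.exp (lam * X ω) ∂P ≤ C := by
  have hmR : (0 : ℝ) < m := by exact_mod_cast hm0
  have hpt : ∀ ω, Real.exp (lam * X ω) ≤
      ∑ i ∈ Finset.range m, (m : ℝ)⁻¹ * Real.exp (ρ * Y i ω) := by
    intro ω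
    have hsum : ∑ _i ∈ Finset.range m, (m : ℝ)⁻¹ = 1 := by simp [hmR.ne']
    have h1 := convexOn_exp.map_sum_le (t := Finset.range m) (w := fun _ => (m : ℝ)⁻¹)
      (p := fun i => ρ * Y i ω) (fun _ _ => by positivity) hsum fun _ _ => mem_univ _
    simp only [smul_eq_mul] at h1
    refine (Real.exp_le_exp.2 ?_).trans h1
    have hS0 : 0 ≤ ∑ i ∈ Finset.range m, Y i ω := (hX0 ω).trans (hXY ω)
    calc lam * X ω ≤ |lam| * X ω := mul_le_mul_of_nonneg_right (le_abs_self _) (hX0 ω)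
      _ ≤ |lam| * ∑ i ∈ Finset.range m, Y i ω := mul_le_mul_of_nonneg_left (hXY ω) (abs_nonneg _)
      _ ≤ (m : ℝ)⁻¹ * ρ * ∑ i ∈ Finset.range m, Y i ω := by
          refine mul_le_mul_of_nonneg_right ?_ hS0
          rw [inv_mul_eq_div, le_div_iff₀ hmR]
          exact hlam
      _ = _ := by
          rw [Finset.mul_sum]
          exact Finset.sum_congr rfl fun i _ => by ring
  have hmeas : Measurable fun ω => Real.exp (lam * X ω) := by fun_prop
  have hle : ∫⁻ ω, ENNReal.ofReal (Real.exp (lam * X ω)) ∂P ≤ ENNReal.ofReal C := by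
    calc _ ≤ ∫⁻ ω, ∑ i ∈ Finset.range m,
          ENNReal.ofReal (m : ℝ)⁻¹ * ENNReal.ofReal (Real.exp (ρ * Y i ω)) ∂P := by
          refine lintegral_mono fun ω => (ENNReal.ofReal_le_ofReal (hpt ω)).trans (le_of_eq ?_)
          rw [ENNReal.ofReal_sum_of_nonneg fun i _ => by positivity]
          exact Finset.sum_congr rfl fun i _ => ENNReal.ofReal_mul (by positivity)
      _ = ∑ i ∈ Finset.range m,
          ENNReal.ofReal (m : ℝ)⁻¹ * ∫⁻ ω, ENNReal.ofReal (Real.exp (ρ * Y i ω)) ∂P := by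
          rw [lintegral_finsetSum _ fun i _ => by have := hY i; fun_prop]
          exact Finset.sum_congr rfl fun i _ => lintegral_const_mul' _ _ ENNReal.ofReal_ne_top
      _ ≤ ∑ _i ∈ Finset.range m, ENNReal.ofReal (m : ℝ)⁻¹ * ENNReal.ofReal C :=
          Finset.sum_le_sum fun i hi => by
            gcongr
            exact hYexp i (Finset.mem_range.1 hi)
      _ = ENNReal.ofReal C := by
          rw [Finset.sum_const, Finset.card_range, nsmul_eq_mul, ← mul_assoc,
            ← ENNReal.ofReal_natCast, ← ENNReal.ofReal_mul hmR.le, mul_inv_cancel₀ hmR.ne',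
            ENNReal.ofReal_one, one_mul]
  have hnn : 0 ≤ᵐ[P] fun ω => Real.exp (lam * X ω) := ae_of_all _ fun ω => (Real.exp_pos _).le
  refine ⟨⟨hmeas.aestronglyMeasurable,
    (hasFiniteIntegral_iff_ofReal hnn).2 (hle.trans_lt ENNReal.ofReal_lt_top)⟩, ?_⟩
  rw [integral_eq_lintegral_of_nonneg_ae hnn hmeas.aestronglyMeasurable]
  exact ENNReal.toReal_le_of_le_ofReal hC hle

end RandomPolygon

theorem proposition6p1 :
    ∃ M₀ ε C : ℝ, 0 < M₀ ∧ 0 < ε ∧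
      ∀ K : Set RandomPolygon.Plane, Convex ℝ K → Bornology.IsBounded K →
      ∀ α β : ℝ, α ≤ β → β ≤ α + 2 * Real.pi →
        M₀ ≤ (RandomPolygon.affineMeasure K (Set.Icc α β)).toReal →
      ∀ lam : ℝ, |lam| < ε / (RandomPolygon.affineMeasure K (Set.Icc α β)).toReal →
        (MeasureTheory.Integrable
            (fun ω => Real.exp (lam * RandomPolygon.edgeCount (RandomPolygon.polygon ω) α β))
            (RandomPolygon.poissonLaw K) ∧
          ∫ ω, Real.exp (lam * RandomPolygon.edgeCount (RandomPolygon.polygon ω) α β)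
            ∂(RandomPolygon.poissonLaw K) ≤ C) ∧
        (MeasureTheory.Integrable
            (fun ω => Real.exp (lam * RandomPolygon.missedArea K (RandomPolygon.polygon ω) α β))
            (RandomPolygon.poissonLaw K) ∧
          ∫ ω, Real.exp (lam * RandomPolygon.missedArea K (RandomPolygon.polygon ω) α β)
            ∂(RandomPolygon.poissonLaw K) ≤ C) := by
  open RandomPolygon in
  have hρ : (0 : ℝ) < localRate := by norm_num [localRate]
  refine ⟨1, localRate / 55, momentBound, one_pos, by positivity, ?_⟩
  intro K hK hb α β hαβ hβ hM lam hlam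
  set M := (affineMeasure K (Icc α β)).toReal with hMdef
  have hM0 : 0 < M := by linarith
  -- The number of pieces is at most `6 (M + 2π) + 1 ≤ 55 M`, as `M ≥ 1`.
  set m := ⌈6 * (M + (β - α))⌉₊ with hm
  have hpos : 0 < 6 * (M + (β - α)) := by linarith
  have hm0 : 0 < m := Nat.ceil_pos.2 hpos
  have hmlt : (m : ℝ) < 6 * (M + (β - α)) + 1 := Nat.ceil_lt_add_one hpos.le
  have hmle : (m : ℝ) ≤ 55 * M := by linarith [Real.pi_lt_four]
  have hlam' : |lam| * m ≤ localRate := by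
    rw [lt_div_iff₀ hM0] at hlam
    have := mul_le_mul_of_nonneg_left hmle (abs_nonneg lam)
    linarith
  have hceil := Nat.le_ceil (6 * (M + (β - α)))
  obtain ⟨t, ht, hcov⟩ := exists_subdivision hb hαβ hm0 (by linarith)
  have hKi : Convex ℝ (interior K) := hK.interior
  have hbi : Bornology.IsBounded (interior K) := hb.subset interior_subset
  have hsmall : ∀ i < m, affineMeasure (interior K) (Icc (t i) (t (i + 1))) ≤
      ENNReal.ofReal (1 / 6) := fun i hi =>
    (affineMeasure_interior_le hK hb measurableSet_Icc).trans (ht i hi).2.2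
  have hpi : ∀ i < m, t (i + 1) < t i + Real.pi := fun i hi => by
    linarith [(ht i hi).2.1, Real.pi_gt_three]
  rw [← poissonLaw_interior hK]
  constructor
  · exact integrable_exp_of_le_sum (measurable_edgeCount α β) (fun ω => edgeCount_nonneg _ _ _)
      hm0 (fun i => measurable_edgeCount (t i) (t (i + 1)))
      (fun ω => edgeCount_le_sum ω hcov) momentBound_nonneg hlam' fun i hi =>
        lintegral_exp_edgeCount_le hKi isOpen_interior hbi (ht i hi).1 (hpi i hi) (hsmall i hi)
  · simp only [← missedArea_interior hK]
    exact integrable_exp_of_le_sum (measurable_missedArea isOpen_interior.measurableSet α β)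
      (fun ω => area_nonneg _) hm0
      (fun i => measurable_missedArea isOpen_interior.measurableSet (t i) (t (i + 1)))
      (fun ω => missedArea_le_sum hbi _ hm0 hcov) momentBound_nonneg hlam' fun i hi =>
        lintegral_exp_missedArea_le hKi isOpen_interior hbi (ht i hi).1 (hpi i hi) (hsmall i hi)
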